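/- Let $d\in\{1,2,3\}$. Write $|\cdot|_p$ for the norm of $L^p(\mathbb R^d)$, $\Lambda=(1-\Delta)^{1/2}$, and $|u|_{H^s}=|\Lambda^s u|_2$ for the norm of the Sobolev space $H^s=H^s(\mathbb R^d)$; functions are real-valued, and $\inf$ and pointwise inequalities are understood up to null sets. For $n\in L^\infty(\mathbb R^d)\cap H^1(\mathbb R^d)$ with $\inf_{\mathbb R^d}(1+n)>0$, put $$c_\infty(n)=\inf_{\mathbb R^d}(1+n)=\big|(1+n)^{-1}\big|_\infty^{-1},\qquad I_1(n)=\frac{1}{c_\infty(n)}|n|_2^2+|n|_{H^1}^2 .$$ **Proposition.** For every $s\ge 0$ there is a finite function $F_s(\cdot,\cdot)$, depending only on $s$ and $d$ and increasing in each of its two arguments, such that the following holds for every $n\in L^\infty(\mathbb R^d)\cap H^1(\mathbb R^d)$ with $\inf_{\mathbb R^d}(1+n)>0$. There is a unique $\phi\in H^3(\mathbb R^d)$ that solves $$-\Delta\phi+e^\phi-1=n \quad\text{on } \mathbb R^d,$$ and this $\phi$ satisfies: (i) $\ln c_\infty(n)\le\phi\le\ln(1+|n|_\infty)$; in particular, if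 $|n|_\infty<1$, then $\ln(1-|n|_\infty)\le\phi\le\ln(1+|n|_\infty)$. (ii) $$\int_{\mathbb R^d}\Big[\frac{c_\infty(n)}{2}|\phi|^2+\frac12|\nabla\phi|^2+|\Delta\phi|^2+2e^\phi|\nabla\phi|^2+\frac12(e^\phi-1)^2\Big]\,dx\le\frac12 I_1(n).$$ (iii) For every $s\ge0$, if moreover $n\in H^s(\mathbb R^d)$, then $\phi\in H^{s+2}(\mathbb R^d)$ and $$|\Lambda^{s+1}\nabla\phi|_2\le F_s\big(I_1(n),|n|_\infty\big)\,\big(1+|n|_{H^s}\big).$$ -/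

import Mathlib

open MeasureTheory TemperedDistribution
open scoped SchwartzMap LineDeriv Laplacian ENNReal

namespace EulerPoisson

noncomputable section

/-- The Euclidean space `ℝᵈ`. -/
abbrev Rd (d : ℕ) : Type := EuclideanSpace ℝ (Fin d)

open Classical in
/-- The tempered distribution attached to a real-valued function of `L²(ℝᵈ)`.
(The value is `0`, never used, if `u` is not in `L²`.) -/
def toDist {d : ℕ} (u : Rd d → ℝ) : 𝓢'(Rd d, ℂ) :=
  if h : MemLp u 2 volume then
    ((MemLp.toLp (fun x => ((u x : ℝ) : ℂ)) h.ofReal : Lp ℂ 2 (volume : Measure (Rd d))) :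
      𝓢'(Rd d, ℂ))
  else 0

/-- The tempered distribution `T` is (given by) the real-valued function `u ∈ L²(ℝᵈ)`. -/
def IsL2Function {d : ℕ} (T : 𝓢'(Rd d, ℂ)) (u : Rd d → ℝ) : Prop :=
  MemLp u 2 volume ∧ T = toDist u

/-- `u ∈ Hˢ(ℝᵈ)`, for `s ≥ 0` and `u` real-valued. -/
def MemHs {d : ℕ} (s : ℝ) (u : Rd d → ℝ) : Prop :=
  MemLp u 2 volume ∧ MemSobolev s 2 (toDist u)

/-- The symbol `(1 + |2πξ|²)^{s/2}` of `Λˢ = (1 - Δ)^{s/2}`; the factor `2π` comes from the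
normalization `∫ e^{-2πi x·ξ} u(x) dx` of the Fourier transform. -/
def lamSymbol {d : ℕ} (s : ℝ) (ξ : Rd d) : ℝ :=
  (1 + (2 * Real.pi * ‖ξ‖) ^ 2) ^ (s / 2)

theorem lamSymbol_hasTemperateGrowth (d : ℕ) (s : ℝ) : (lamSymbol s : Rd d → ℝ).HasTemperateGrowth := by
  have h := Function.hasTemperateGrowth_one_add_norm_sq_rpow (Rd d) (s / 2)
  have h2 : (fun ξ : Rd d => (2 * Real.pi) • ξ).HasTemperateGrowth := by fun_prop
  have e : (lamSymbol s : Rd d → ℝ) =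
      (fun x : Rd d => (1 + ‖x‖ ^ 2) ^ (s / 2)) ∘ fun ξ : Rd d => (2 * Real.pi) • ξ := by
    funext ξ
    simp [lamSymbol, norm_smul, abs_of_pos Real.pi_pos]
  rw [e]
  exact h.comp h2

/-- The Fourier multiplier `Λˢ = (1 - Δ)^{s/2}` on tempered distributions. -/
def Lam {d : ℕ} (s : ℝ) : 𝓢'(Rd d, ℂ) →L[ℂ] 𝓢'(Rd d, ℂ) :=
  fourierMultiplierCLM ℂ (fun ξ : Rd d => ((lamSymbol s ξ : ℝ) : ℂ))

/-- The `L²` norm of a tempered distribution, equal to `∞` if it is not an `L²` function. -/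
def l2Norm {d : ℕ} (T : 𝓢'(Rd d, ℂ)) : ℝ≥0∞ :=
  ⨅ (f : Lp ℂ 2 (volume : Measure (Rd d))) (_ : T = (f : 𝓢'(Rd d, ℂ))), ‖f‖ₑ

/-- The norm `|u|_{Hˢ} = |Λˢ u|₂`. -/
def hsNorm {d : ℕ} (s : ℝ) (u : Rd d → ℝ) : ℝ := (l2Norm (Lam s (toDist u))).toReal

/-- The distributional partial derivative `∂ᵢ`. -/
def partialD {d : ℕ} (i : Fin d) (T : 𝓢'(Rd d, ℂ)) : 𝓢'(Rd d, ℂ) :=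
  ∂_{(EuclideanSpace.single i (1 : ℝ) : Rd d)} T

/-- `|Λʳ ∇u|₂`, with value `∞` if `Λʳ ∇u` is not in `L²`. -/
def lamGradNorm {d : ℕ} (r : ℝ) (u : Rd d → ℝ) : ℝ≥0∞ :=
  (∑ i : Fin d, l2Norm (Lam r (partialD i (toDist u))) ^ 2) ^ (1 / 2 : ℝ)

/-- `G : ℝᵈ → ℝᵈ` is the gradient of `u`, in the sense of distributions and with components
in `L²`. -/
def IsGrad {d : ℕ} (u : Rd d → ℝ) (G : Rd d → Rd d) : Prop :=
  ∀ i : Fin d, IsL2Function (partialD i (toDist u)) (fun x => G x i)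

/-- `ℓ` is the Laplacian of `u`, in the sense of distributions and in `L²`. -/
def IsLaplacian {d : ℕ} (u ℓ : Rd d → ℝ) : Prop :=
  IsL2Function (Δ (toDist u)) ℓ

/-- `φ` solves `-Δφ + e^φ - 1 = n`, almost everywhere on `ℝᵈ`. -/
def Solves {d : ℕ} (n φ : Rd d → ℝ) : Prop :=
  ∃ ℓ : Rd d → ℝ, IsLaplacian φ ℓ ∧ ∀ᵐ x, -ℓ x + Real.exp (φ x) - 1 = n x

/-- `c_∞(n) = inf (1 + n)`, the essential infimum; when it is positive it equals
`1 / |(1 + n)⁻¹|_∞`. -/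
def cInf {d : ℕ} (n : Rd d → ℝ) : ℝ := essInf (fun x => 1 + n x) volume

/-- `I₁(n) = |n|₂² / c_∞(n) + |n|_{H¹}²`. -/
def I1 {d : ℕ} (n : Rd d → ℝ) : ℝ := 1 / cInf n * lpNorm n 2 volume ^ 2 + hsNorm 1 n ^ 2

end

end EulerPoisson

open EulerPoisson

namespace EulerPoisson

noncomputable section

open FourierTransform Filter Topology
open scoped ComplexConjugate NNReal

variable {d : ℕ}

/-! Existence and (i) come together from a truncation. Write c for the lower bound of 1 + n and b
for |n|_∞. Outside [ln c, ln(1 + b)] the function e^t - 1 is continued affinely with slope c, which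
gives a nonlinearity g with slopes between c and K = 1 + b. The equation -Δφ + g(φ) = n is then a
fixed point problem φ = (K - Δ)⁻¹(Kφ - g(φ) + n), a contraction of L² with factor 1 - c/K
(`exists_solution_of_slopes`). The excess T(φ) of φ over the interval is a nondecreasing function of
φ, so ⟨-Δφ, T(φ)⟩ ≥ 0 (`integral_lap_mul_comp_nonpos`); testing with it forces T(φ) = 0, and the
truncation is inactive (`exists_solution`). The same monotonicity gives uniqueness.

The energy inequality (ii) is the sum of the pairings of the equation with φ, -Δφ and e^φ - 1, each
closed by Young's inequality (`Sol.energy`).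

For (iii), the identity ∂ᵢ(e^φ - 1) = ∂ᵢφ + (e^φ - 1)∂ᵢφ and the product estimate |fg|_{H^s} ≲
|f|_{H^s}|g|_{H²} + |f|_{H¹}|g|_{H^{s+1}} (`exists_sob_mul_le`) bound e^φ - 1 in H^{s+1} by its H^s
norm and by Λ^{s+1}∇φ. The equation in turn bounds Λ^{s+1}∇φ by the H^s norms of e^φ - 1 and n and
by |∇φ|₂. Alternating the two raises s by one at each round. In every product one factor is a low
norm, |e^φ - 1|_{H¹} or |Λ²∇φ|₂, already polynomial in I₁ and |n|_∞, so the result stays linear in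
|n|_{H^s}. The norm |φ|₂ is kept out of these quantitative bounds, since the energy controls it only
with the factor c.

Everything linear is done on the Fourier side of L². Nonlinear facts about weak derivatives (chain
rule, Lipschitz composition, monotonicity) are proved for difference quotients, whose symbols
converge to that of ∂ᵢ and are dominated by it. -/

/-- Locally integrable functions that agree against all Schwartz functions agree a.e. -/
theorem ae_eq_of_forall_schwartz {F G : Rd d → ℂ} (hF : LocallyIntegrable F volume)
    (hG : LocallyIntegrable G volume)
    (h : ∀ θ : 𝓢(Rd d, ℂ), ∫ x, θ x * F x = ∫ x, θ x * G x) : F =ᵐ[volume] G := by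
  apply ae_eq_of_integral_contDiff_smul_eq hF hG
  intro g g_smooth g_cpt
  have hg₁ : HasCompactSupport (Complex.ofRealCLM ∘ g) := g_cpt.comp_left rfl
  have hg₂ : ContDiff ℝ (⊤ : ℕ∞) (Complex.ofRealCLM ∘ g) := by fun_prop
  have := h (hg₁.toSchwartzMap hg₂)
  simpa using this

/-! ### The L² Fourier transform of real functions -/

/-- The `L²` class of the complexification of a real `L²` function. -/
def toL2 (u : Rd d → ℝ) (h : MemLp u 2 volume) : Lp ℂ 2 (volume : Measure (Rd d)) :=
  MemLp.toLp (fun x => ((u x : ℝ) : ℂ)) h.ofReal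

theorem coeFn_toL2 {u : Rd d → ℝ} (h : MemLp u 2 volume) :
    toL2 u h =ᵐ[volume] fun x => ((u x : ℝ) : ℂ) := MemLp.coeFn_toLp _

theorem toDist_eq {u : Rd d → ℝ} (h : MemLp u 2 volume) :
    toDist u = (toL2 u h : 𝓢'(Rd d, ℂ)) := by
  simp [toDist, h, toL2]

/-- The Fourier transform in `L²` of a real `L²` function. -/
def ftL2 (u : Rd d → ℝ) (h : MemLp u 2 volume) : Lp ℂ 2 (volume : Measure (Rd d)) :=
  𝓕 (toL2 u h)

open Classical in
/-- The `L²` Fourier transform of a real-valued function of `L²`. -/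
def ft (u : Rd d → ℝ) : Rd d → ℂ :=
  if h : MemLp u 2 volume then ⇑(ftL2 u h) else 0

theorem ft_eq {u : Rd d → ℝ} (h : MemLp u 2 volume) : ft u = ⇑(ftL2 u h) := by
  simp [ft, h]

theorem memLp_ft (u : Rd d → ℝ) : MemLp (ft u) 2 volume := by
  by_cases h : MemLp u 2 volume
  · rw [ft_eq h]; exact Lp.memLp _
  · simp [ft, h]

theorem aestronglyMeasurable_ft (u : Rd d → ℝ) : AEStronglyMeasurable (ft u) volume :=
  (memLp_ft u).1

theorem toL2_congr {u v : Rd d → ℝ} (h : MemLp u 2 volume) (h' : MemLp v 2 volume)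
    (e : u =ᵐ[volume] v) : toL2 u h = toL2 v h' := by
  apply (MemLp.toLp_eq_toLp_iff _ _).2
  filter_upwards [e] with x hx
  simp [hx]

theorem ft_congr {u v : Rd d → ℝ} (e : u =ᵐ[volume] v) : ft u = ft v := by
  by_cases h : MemLp u 2 volume
  · have h' := (memLp_congr_ae e).1 h
    rw [ft_eq h, ft_eq h', ftL2, ftL2, toL2_congr h h' e]
  · have h' : ¬ MemLp v 2 volume := fun h' => h ((memLp_congr_ae e).2 h')
    simp [ft, h, h']

theorem ft_add {u v : Rd d → ℝ} (hu : MemLp u 2 volume) (hv : MemLp v 2 volume) :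
    ft (fun x => u x + v x) =ᵐ[volume] fun ξ => ft u ξ + ft v ξ := by
  have e : toL2 (fun x => u x + v x) (hu.add hv) = toL2 u hu + toL2 v hv := by
    rw [toL2, toL2, toL2, ← MemLp.toLp_add]
    apply (MemLp.toLp_eq_toLp_iff _ _).2
    filter_upwards with x
    simp
  have hs : MemLp (fun x => u x + v x) 2 volume := hu.add hv
  rw [ft_eq hs, ft_eq hu, ft_eq hv, ftL2, e, FourierTransform.fourier_add]
  exact Lp.coeFn_add _ _

theorem ft_const_mul {u : Rd d → ℝ} (c : ℝ) (hu : MemLp u 2 volume) :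
    ft (fun x => c * u x) =ᵐ[volume] fun ξ => (c : ℂ) * ft u ξ := by
  have e : toL2 (fun x => c * u x) (hu.const_mul c) = (c : ℂ) • toL2 u hu := by
    rw [toL2, toL2, ← MemLp.toLp_const_smul]
    apply (MemLp.toLp_eq_toLp_iff _ _).2
    filter_upwards with x
    simp
  rw [ft_eq (hu.const_mul c), ft_eq hu, ftL2, e, FourierTransform.fourier_smul]
  exact Lp.coeFn_smul _ _

theorem ft_sub {u v : Rd d → ℝ} (hu : MemLp u 2 volume) (hv : MemLp v 2 volume) :
    ft (fun x => u x - v x) =ᵐ[volume] fun ξ => ft u ξ - ft v ξ := by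
  have e : toL2 (fun x => u x - v x) (hu.sub hv) = toL2 u hu - toL2 v hv := by
    rw [toL2, toL2, toL2, ← MemLp.toLp_sub]
    apply (MemLp.toLp_eq_toLp_iff _ _).2
    filter_upwards with x
    simp
  have hs : MemLp (fun x => u x - v x) 2 volume := hu.sub hv
  rw [ft_eq hs, ft_eq hu, ft_eq hv, ftL2, e, sub_eq_add_neg, FourierTransform.fourier_add,
    FourierTransform.fourier_neg, ← sub_eq_add_neg]
  exact Lp.coeFn_sub _ _

theorem eLpNorm_ft {u : Rd d → ℝ} (hu : MemLp u 2 volume) :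
    eLpNorm (ft u) 2 volume = eLpNorm u 2 volume := by
  rw [ft_eq hu, ← Lp.enorm_def, ftL2, ← ofReal_norm, Lp.norm_fourier_eq, ofReal_norm,
    Lp.enorm_def, eLpNorm_congr_ae (coeFn_toL2 hu)]
  apply eLpNorm_congr_norm_ae
  filter_upwards with x
  simp

theorem integral_mul_eq_ft {u v : Rd d → ℝ} (hu : MemLp u 2 volume) (hv : MemLp v 2 volume) :
    ∫ x, u x * v x = ∫ ξ, (ft u ξ * conj (ft v ξ)).re := by
  have h := Lp.inner_fourier_eq (toL2 v hv) (toL2 u hu)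
  rw [L2.inner_def, L2.inner_def] at h
  have hint : Integrable (fun ξ => ft u ξ * conj (ft v ξ)) volume := by
    have := L2.integrable_inner (𝕜 := ℂ) (𝓕 (toL2 v hv)) (𝓕 (toL2 u hu))
    simpa [ft_eq hu, ft_eq hv, RCLike.inner_apply, ftL2] using this
  have e1 : ∫ x, inner ℂ (toL2 v hv x) (toL2 u hu x) = ((∫ x, u x * v x : ℝ) : ℂ) := by
    rw [← integral_complex_ofReal]
    apply integral_congr_ae
    filter_upwards [coeFn_toL2 hu, coeFn_toL2 hv] with x h1 h2
    simp [h1, h2]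
  have e2 : ∫ x, inner ℂ (𝓕 (toL2 v hv) x) (𝓕 (toL2 u hu) x) = ∫ ξ, ft u ξ * conj (ft v ξ) := by
    simp [ft_eq hu, ft_eq hv, RCLike.inner_apply, ftL2]
  rw [e1, e2] at h
  have h2 := congrArg Complex.re h
  rw [Complex.ofReal_re] at h2
  rw [← h2]
  exact (integral_re hint).symm

/-- The L² transform agrees with the distributional one. This is the bridge by which identities for
`ft` are reduced, via `ae_eq_of_forall_schwartz`, to explicit integrals of Schwartz functions. -/
theorem integral_schwartz_mul_ft {u : Rd d → ℝ} (hu : MemLp u 2 volume) (θ : 𝓢(Rd d, ℂ)) :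
    ∫ ξ, θ ξ * ft u ξ = ∫ x, 𝓕 θ x * (u x : ℂ) := by
  have h := Lp.fourier_toTemperedDistribution_eq (toL2 u hu)
  have h1 := DFunLike.congr_fun h θ
  rw [TemperedDistribution.fourier_apply, Lp.toTemperedDistribution_apply,
    Lp.toTemperedDistribution_apply] at h1
  simp only [smul_eq_mul] at h1
  rw [ft_eq hu, ftL2, ← h1]
  apply integral_congr_ae
  filter_upwards [coeFn_toL2 hu] with x hx
  rw [hx]

theorem _root_.MeasureTheory.MemLp.locallyIntegrable_two {F : Rd d → ℂ} (h : MemLp F 2 volume) :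
    LocallyIntegrable F volume := h.locallyIntegrable (by norm_num)

/-- The Fourier transform of a real function is conjugate symmetric. -/
theorem ft_neg {u : Rd d → ℝ} (hu : MemLp u 2 volume) :
    (fun ξ => ft u (-ξ)) =ᵐ[volume] fun ξ => conj (ft u ξ) := by
  have hmp : MeasurePreserving (fun x : Rd d => -x) volume volume := Measure.measurePreserving_neg _
  have h1 : MemLp (fun ξ => ft u (-ξ)) 2 volume := (memLp_ft u).comp_measurePreserving hmp
  apply ae_eq_of_forall_schwartz h1.locallyIntegrable_two (memLp_ft u).star.locallyIntegrable_two
  intro θ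
  -- Reflection and conjugation are moved onto the test function, where the symmetry of the Fourier
  -- integral is a change of variables.
  let η : 𝓢(Rd d, ℂ) := θ.postcompCLM (Complex.conjCLE : ℂ →L[ℝ] ℂ)
  let θ' : 𝓢(Rd d, ℂ) := SchwartzMap.compCLMOfContinuousLinearEquiv ℂ
    (ContinuousLinearEquiv.neg ℝ (M := Rd d)) θ
  have hη (x : Rd d) : η x = conj (θ x) := rfl
  have hθ' (x : Rd d) : θ' x = θ (-x) := rfl
  have e1 : ∫ x, θ x * ft u (-x) = ∫ x, θ' x * ft u x := by
    rw [← integral_neg_eq_self]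
    simp [hθ']
  have e2 : ∫ x, θ x * conj (ft u x) = conj (∫ x, η x * ft u x) := by
    rw [← integral_conj]
    simp [hη]
  rw [e1]
  change _ = ∫ x, θ x * conj (ft u x)
  rw [e2, integral_schwartz_mul_ft hu, integral_schwartz_mul_ft hu, ← integral_conj]
  congr 1
  ext x
  rw [map_mul, Complex.conj_ofReal]
  congr 1
  rw [SchwartzMap.fourier_coe, SchwartzMap.fourier_coe, Real.fourier_eq', Real.fourier_eq',
    ← integral_conj, ← integral_neg_eq_self]
  congr 1
  ext y
  simp [hη, hθ', ← Complex.exp_conj, Complex.conj_ofNat]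

/-! ### Translations and conjugate symmetry -/

theorem fourier_compSubConst (a : Rd d) (f : 𝓢(Rd d, ℂ)) (ξ : Rd d) :
    𝓕 (f.compSubConstCLM ℂ a) ξ
      = Complex.exp (((-2 * Real.pi * inner ℝ a ξ : ℝ) : ℂ) * Complex.I) * 𝓕 f ξ := by
  rw [SchwartzMap.fourier_coe, SchwartzMap.fourier_coe, Real.fourier_eq', Real.fourier_eq',
    ← integral_const_mul, ← integral_add_right_eq_self _ a]
  congr 1
  ext y
  simp only [SchwartzMap.compSubConstCLM_apply, add_sub_cancel_right, smul_eq_mul, inner_add_left]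
  rw [← mul_assoc, ← Complex.exp_add]
  congr 2
  push_cast
  ring

/-- The symbol of the translation `u ↦ u (· + h)`. -/
def trSymbol (h ξ : Rd d) : ℂ := Complex.exp (((2 * Real.pi * inner ℝ h ξ : ℝ) : ℂ) * Complex.I)

theorem norm_trSymbol (h ξ : Rd d) : ‖trSymbol h ξ‖ = 1 := Complex.norm_exp_ofReal_mul_I _

theorem continuous_trSymbol (h : Rd d) : Continuous (trSymbol h) := by
  unfold trSymbol; fun_prop

theorem memLp_translate {u : Rd d → ℝ} (hu : MemLp u 2 volume) (h : Rd d) :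
    MemLp (fun x => u (x + h)) 2 volume :=
  hu.comp_measurePreserving (measurePreserving_add_right volume h)

theorem memLp_bounded_mul {m F : Rd d → ℂ} (hF : MemLp F 2 volume)
    (hm : AEStronglyMeasurable m volume) (C : ℝ) (h : ∀ᵐ ξ, ‖m ξ‖ ≤ C) :
    MemLp (fun ξ => m ξ * F ξ) 2 volume := by
  refine hF.of_le_mul (c := C) (hm.mul hF.1) ?_
  filter_upwards [h] with ξ hξ
  rw [norm_mul]
  gcongr

theorem ft_translate {u : Rd d → ℝ} (hu : MemLp u 2 volume) (h : Rd d) :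
    ft (fun x => u (x + h)) =ᵐ[volume] fun ξ => trSymbol h ξ * ft u ξ := by
  have hm : MemLp (fun ξ => trSymbol h ξ * ft u ξ) 2 volume :=
    memLp_bounded_mul (memLp_ft u) (continuous_trSymbol h).aestronglyMeasurable 1
      (.of_forall fun ξ => (norm_trSymbol h ξ).le)
  apply ae_eq_of_forall_schwartz (memLp_ft _).locallyIntegrable_two hm.locallyIntegrable_two
  intro θ
  -- The modulated test function is built as the transform of a translate, so that it is a Schwartz
  -- function by construction.
  let ζ : 𝓢(Rd d, ℂ) := 𝓕 ((𝓕⁻ θ).compSubConstCLM ℂ (-h))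
  have hζ (ξ : Rd d) : ζ ξ = trSymbol h ξ * θ ξ := by
    have := fourier_compSubConst (-h) (𝓕⁻ θ) ξ
    rw [FourierTransform.fourier_fourierInv_eq] at this
    rw [this, trSymbol]
    simp
  have e1 : ∫ ξ, θ ξ * (trSymbol h ξ * ft u ξ) = ∫ ξ, ζ ξ * ft u ξ := by
    congr 1
    ext ξ
    rw [hζ]; ring
  rw [e1, integral_schwartz_mul_ft hu, integral_schwartz_mul_ft (memLp_translate hu h)]
  conv_rhs => rw [← integral_add_right_eq_self _ h]
  congr 1
  ext x
  congr 1
  rw [SchwartzMap.fourier_coe, SchwartzMap.fourier_coe, Real.fourier_eq', Real.fourier_eq']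
  congr 1
  ext y
  rw [hζ, smul_eq_mul, smul_eq_mul, trSymbol, ← mul_assoc, ← Complex.exp_add, inner_add_right,
    real_inner_comm h y]
  congr 2
  push_cast
  ring

/-- A conjugate symmetric `L²` function is the Fourier transform of a real `L²` function. -/
theorem exists_ft_eq {F : Rd d → ℂ} (hF : MemLp F 2 volume)
    (hs : (fun ξ => F (-ξ)) =ᵐ[volume] fun ξ => conj (F ξ)) :
    ∃ u : Rd d → ℝ, MemLp u 2 volume ∧ ft u =ᵐ[volume] F := by
  let f : Lp ℂ 2 (volume : Measure (Rd d)) := 𝓕⁻ (hF.toLp F)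
  have hf : MemLp (fun x => f x) 2 volume := Lp.memLp f
  let u : Rd d → ℝ := fun x => (f x).re
  let v : Rd d → ℝ := fun x => (f x).im
  have hu : MemLp u 2 volume := hf.re
  have hv : MemLp v 2 volume := hf.im
  have hfuv : f = toL2 u hu + Complex.I • toL2 v hv := by
    apply Lp.ext
    filter_upwards [coeFn_toL2 hu, coeFn_toL2 hv,
      Lp.coeFn_add (toL2 u hu) (Complex.I • toL2 v hv), Lp.coeFn_smul Complex.I (toL2 v hv)]
      with x h1 h2 h3 h4
    rw [h3, Pi.add_apply, h4, Pi.smul_apply, h1, h2, smul_eq_mul, mul_comm]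
    exact (Complex.re_add_im (f x)).symm
  have h1 : F =ᵐ[volume] fun ξ => ft u ξ + Complex.I * ft v ξ := by
    have e : hF.toLp F = 𝓕 f := by simp [f]
    rw [hfuv, FourierTransform.fourier_add, FourierTransform.fourier_smul] at e
    rw [ft_eq hu, ft_eq hv, ftL2, ftL2]
    filter_upwards [hF.coeFn_toLp, Lp.coeFn_add (𝓕 (toL2 u hu)) (Complex.I • 𝓕 (toL2 v hv)),
      Lp.coeFn_smul Complex.I (𝓕 (toL2 v hv))] with ξ h1 h2 h3
    rw [← h1, e, h2, Pi.add_apply, h3]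
    rfl
  have hmp : MeasurePreserving (fun x : Rd d => -x) volume volume := Measure.measurePreserving_neg _
  have h2 := hmp.quasiMeasurePreserving.ae_eq_comp h1
  -- With F = û + i v̂ and u, v real, the symmetry of F, û and v̂ turns the value at -ξ into conj û
  -- + i conj v̂, while conj F = conj û - i conj v̂. Hence v̂ = 0.
  have h3 : ft v =ᵐ[volume] fun _ => 0 := by
    filter_upwards [h1, h2, hs, ft_neg hu, ft_neg hv] with ξ h1 h2 h3 h4 h5
    simp only [Function.comp_apply] at h2
    rw [h2, h1, h4, h5, map_add, map_mul, Complex.conj_I] at h3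
    have h6 : Complex.I * conj (ft v ξ) = 0 := by linear_combination h3 / 2
    simpa using h6
  refine ⟨u, hu, ?_⟩
  filter_upwards [h1, h3] with ξ h1 h3
  rw [h1, h3]; simp

/-! ### Fourier multipliers of L² functions -/

theorem smulLeft_apply {u : Rd d → ℝ} (hu : MemLp u 2 volume) {m : Rd d → ℂ}
    (hm : m.HasTemperateGrowth) (θ : 𝓢(Rd d, ℂ)) :
    smulLeftCLM ℂ m (𝓕 (toDist u)) θ = ∫ ξ, θ ξ * (m ξ * ft u ξ) := by
  rw [toDist_eq hu, Lp.fourier_toTemperedDistribution_eq, smulLeftCLM_apply_apply,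
    Lp.toTemperedDistribution_apply, ft_eq hu]
  congr 1
  ext ξ
  rw [SchwartzMap.smulLeftCLM_apply_apply hm, ftL2]
  simp only [smul_eq_mul]
  ring

/-- A Fourier multiplier of a real `L²` function is an `L²` function exactly when its symbol times
the Fourier transform is. -/
theorem multiplier_eq_iff {u : Rd d → ℝ} (hu : MemLp u 2 volume) {m : Rd d → ℂ}
    (hm : m.HasTemperateGrowth) (f : Lp ℂ 2 (volume : Measure (Rd d))) :
    fourierMultiplierCLM ℂ m (toDist u) = (f : 𝓢'(Rd d, ℂ)) ↔
      (fun ξ => m ξ * ft u ξ) =ᵐ[volume] (𝓕 f : Lp ℂ 2 (volume : Measure (Rd d))) := by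
  have e : fourierMultiplierCLM ℂ m (toDist u) = (f : 𝓢'(Rd d, ℂ)) ↔
      smulLeftCLM ℂ m (𝓕 (toDist u)) = ((𝓕 f : Lp ℂ 2 (volume : Measure (Rd d))) : 𝓢'(Rd d, ℂ)) := by
    rw [fourierMultiplierCLM_apply, ← Lp.fourier_toTemperedDistribution_eq]
    constructor
    · intro h
      rw [← h, FourierTransform.fourier_fourierInv_eq]
    · intro h
      rw [h, FourierTransform.fourierInv_fourier_eq]
  rw [e]
  constructor
  · intro h
    apply ae_eq_of_forall_schwartz
    · exact (memLp_ft u).locallyIntegrable_two.continuous_mul hm.1.continuous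
    · exact (Lp.memLp _).locallyIntegrable_two
    · intro θ
      rw [← smulLeft_apply hu hm, h, Lp.toTemperedDistribution_apply]
      rfl
  · intro h
    ext θ
    rw [smulLeft_apply hu hm, Lp.toTemperedDistribution_apply]
    apply integral_congr_ae
    filter_upwards [h] with ξ hξ
    rw [hξ]; rfl

theorem exists_multiplier_eq {u : Rd d → ℝ} (hu : MemLp u 2 volume) {m : Rd d → ℂ}
    (hm : m.HasTemperateGrowth) (h : MemLp (fun ξ => m ξ * ft u ξ) 2 volume) :
    ∃ f : Lp ℂ 2 (volume : Measure (Rd d)),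
      fourierMultiplierCLM ℂ m (toDist u) = (f : 𝓢'(Rd d, ℂ)) := by
  refine ⟨𝓕⁻ (h.toLp _), (multiplier_eq_iff hu hm _).2 ?_⟩
  rw [FourierTransform.fourier_fourierInv_eq]
  exact h.coeFn_toLp.symm

theorem memLp_of_multiplier_eq {u : Rd d → ℝ} (hu : MemLp u 2 volume) {m : Rd d → ℂ}
    (hm : m.HasTemperateGrowth) {f : Lp ℂ 2 (volume : Measure (Rd d))}
    (h : fourierMultiplierCLM ℂ m (toDist u) = (f : 𝓢'(Rd d, ℂ))) :
    MemLp (fun ξ => m ξ * ft u ξ) 2 volume :=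
  (memLp_congr_ae ((multiplier_eq_iff hu hm f).1 h)).2 (Lp.memLp _)

theorem memLp_symbol_mul_iff {u : Rd d → ℝ} {m : Rd d → ℂ} (hm : Continuous m) :
    MemLp (fun ξ => m ξ * ft u ξ) 2 volume ↔ eLpNorm (fun ξ => m ξ * ft u ξ) 2 volume < ∞ :=
  ⟨fun h => h.2, fun h => ⟨hm.aestronglyMeasurable.mul (aestronglyMeasurable_ft u), h⟩⟩

/-- Every L² representative has transform m û, so all terms of the infimum defining `l2Norm`
coincide by Plancherel. If m û is not in L², the bound by ∞ is trivial. -/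
theorem l2Norm_multiplier {u : Rd d → ℝ} (hu : MemLp u 2 volume) {m : Rd d → ℂ}
    (hm : m.HasTemperateGrowth) :
    l2Norm (fourierMultiplierCLM ℂ m (toDist u)) = eLpNorm (fun ξ => m ξ * ft u ξ) 2 volume := by
  have key (f : Lp ℂ 2 (volume : Measure (Rd d)))
      (h : fourierMultiplierCLM ℂ m (toDist u) = (f : 𝓢'(Rd d, ℂ))) :
      ‖f‖ₑ = eLpNorm (fun ξ => m ξ * ft u ξ) 2 volume := by
    rw [eLpNorm_congr_ae ((multiplier_eq_iff hu hm f).1 h), ← Lp.enorm_def, ← ofReal_norm,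
      ← ofReal_norm, Lp.norm_fourier_eq]
  apply le_antisymm
  · by_cases h : eLpNorm (fun ξ => m ξ * ft u ξ) 2 volume < ∞
    · obtain ⟨f, hf⟩ := exists_multiplier_eq hu hm ((memLp_symbol_mul_iff hm.1.continuous).2 h)
      rw [← key f hf]
      exact iInf₂_le f hf
    · rw [not_lt_top_iff.1 h]; exact le_top
  · exact le_iInf₂ fun f hf => (key f hf).ge

/-! ### The concrete symbols -/

theorem continuous_lamSymbol (s : ℝ) : Continuous (lamSymbol s : Rd d → ℝ) :=
  (lamSymbol_hasTemperateGrowth d s).1.continuous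

theorem lamSymbol_complex_growth (s : ℝ) :
    (fun ξ : Rd d => ((lamSymbol s ξ : ℝ) : ℂ)).HasTemperateGrowth := by
  have := lamSymbol_hasTemperateGrowth d s
  fun_prop

theorem lamSymbol_pos (s : ℝ) (ξ : Rd d) : 0 < lamSymbol s ξ := by
  unfold lamSymbol; positivity

theorem lamSymbol_mono {s t : ℝ} (h : s ≤ t) (ξ : Rd d) : lamSymbol s ξ ≤ lamSymbol t ξ :=
  Real.rpow_le_rpow_of_exponent_le (by nlinarith [sq_nonneg (2 * Real.pi * ‖ξ‖)]) (by linarith)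

theorem lamSymbol_add (s t : ℝ) (ξ : Rd d) :
    lamSymbol (s + t) ξ = lamSymbol s ξ * lamSymbol t ξ := by
  unfold lamSymbol
  rw [← Real.rpow_add (by positivity)]
  congr 1; ring

theorem lamSymbol_zero (ξ : Rd d) : lamSymbol 0 ξ = 1 := by simp [lamSymbol]

theorem lamSymbol_two (ξ : Rd d) : lamSymbol 2 ξ = 1 + (2 * Real.pi * ‖ξ‖) ^ 2 := by
  simp [lamSymbol]

theorem lamSymbol_one_sq (ξ : Rd d) : lamSymbol 1 ξ ^ 2 = 1 + (2 * Real.pi * ‖ξ‖) ^ 2 := by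
  rw [← lamSymbol_two, sq, ← lamSymbol_add]; norm_num

/-- The extended `Hˢ` norm, computed on the Fourier side. -/
def sob (s : ℝ) (u : Rd d → ℝ) : ℝ≥0∞ :=
  eLpNorm (fun ξ => ((lamSymbol s ξ : ℝ) : ℂ) * ft u ξ) 2 volume

theorem l2Norm_Lam {u : Rd d → ℝ} (hu : MemLp u 2 volume) (s : ℝ) :
    l2Norm (Lam s (toDist u)) = sob s u := l2Norm_multiplier hu (lamSymbol_complex_growth s)

theorem hsNorm_eq {u : Rd d → ℝ} (hu : MemLp u 2 volume) (s : ℝ) :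
    hsNorm s u = (sob s u).toReal := by
  rw [hsNorm, l2Norm_Lam hu]

/-- `MemSobolev` uses the weight 1 + |ξ|² and `lamSymbol` uses 1 + |2πξ|². Their ratio lies between
1 and (2π)², so membership is the same although the norms differ. -/
theorem memHs_iff {s : ℝ} (hs : 0 ≤ s) {u : Rd d → ℝ} :
    MemHs s u ↔ MemLp u 2 volume ∧ sob s u < ∞ := by
  unfold MemHs
  apply and_congr_right
  intro hu
  have hgr : (fun x : Rd d => (((1 + ‖x‖ ^ 2) ^ (s / 2) : ℝ) : ℂ)).HasTemperateGrowth := by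
    fun_prop
  have h1 : MemSobolev s 2 (toDist u) ↔
      MemLp (fun ξ => (((1 + ‖ξ‖ ^ 2) ^ (s / 2) : ℝ) : ℂ) * ft u ξ) 2 volume := by
    constructor
    · rintro ⟨f, hf⟩
      exact memLp_of_multiplier_eq hu hgr hf
    · intro h
      exact exists_multiplier_eq hu hgr h
  have hcont : Continuous fun ξ : Rd d => ((lamSymbol s ξ : ℝ) : ℂ) :=
    (lamSymbol_complex_growth s).1.continuous
  rw [h1, sob, ← memLp_symbol_mul_iff hcont]
  have hpi : 1 ≤ (2 * Real.pi) ^ 2 := by nlinarith [Real.pi_gt_three]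
  constructor
  · intro h
    refine h.of_le_mul (c := ((2 * Real.pi) ^ 2) ^ (s / 2))
      (hcont.aestronglyMeasurable.mul (aestronglyMeasurable_ft u)) (.of_forall fun ξ => ?_)
    rw [norm_mul, norm_mul, ← mul_assoc, Complex.norm_real, Complex.norm_real,
      Real.norm_of_nonneg (lamSymbol_pos s ξ).le,
      Real.norm_of_nonneg (by positivity : 0 ≤ (1 + ‖ξ‖ ^ 2) ^ (s / 2)), ← Real.mul_rpow (by positivity) (by positivity), lamSymbol]
    gcongr
    nlinarith [sq_nonneg ‖ξ‖]
  · intro h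
    refine h.of_le ((hgr.1.continuous).aestronglyMeasurable.mul (aestronglyMeasurable_ft u))
      (.of_forall fun ξ => ?_)
    rw [norm_mul, norm_mul, Complex.norm_real, Complex.norm_real,
      Real.norm_of_nonneg (by positivity), Real.norm_of_nonneg (lamSymbol_pos s ξ).le, lamSymbol]
    gcongr
    nlinarith [norm_nonneg ξ, Real.pi_gt_three]

/-- The symbol `2πi ξᵢ` of `∂ᵢ`. -/
def dSymbol (i : Fin d) (ξ : Rd d) : ℂ := ((2 * Real.pi * ξ i : ℝ) : ℂ) * Complex.I

/-- The symbol `-(2π|ξ|)²` of the Laplacian. -/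
def lapSymbol (ξ : Rd d) : ℂ := ((-(2 * Real.pi * ‖ξ‖) ^ 2 : ℝ) : ℂ)

theorem dSymbol_growth (i : Fin d) : (dSymbol i : Rd d → ℂ).HasTemperateGrowth := by
  have h : (fun ξ : Rd d => ξ i).HasTemperateGrowth :=
    (EuclideanSpace.proj (𝕜 := ℝ) i).hasTemperateGrowth
  unfold dSymbol
  fun_prop

theorem lapSymbol_growth : (lapSymbol : Rd d → ℂ).HasTemperateGrowth := by
  have : (lapSymbol : Rd d → ℂ) = fun ξ => ((-(2 * Real.pi) ^ 2 * ‖ξ‖ ^ 2 : ℝ) : ℂ) := by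
    ext ξ; simp only [lapSymbol]; congr 1; ring
  rw [this]
  fun_prop

theorem partialD_eq (i : Fin d) (T : 𝓢'(Rd d, ℂ)) :
    partialD i T = fourierMultiplierCLM ℂ (dSymbol i) T := by
  have h : (fun ξ : Rd d => ((inner ℝ ξ (EuclideanSpace.single i (1 : ℝ)) : ℝ) : ℂ)).HasTemperateGrowth := by
    fun_prop
  rw [partialD, lineDeriv_eq_fourierMultiplierCLM, ← _root_.smul_apply,
    ← fourierMultiplierCLM_smul h]
  congr 2
  ext ξ
  simp [dSymbol, EuclideanSpace.inner_single_right]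
  ring

theorem laplacian_eq (T : 𝓢'(Rd d, ℂ)) :
    Δ T = fourierMultiplierCLM ℂ lapSymbol T := by
  have h : (fun ξ : Rd d => ((‖ξ‖ ^ 2 : ℝ) : ℂ)).HasTemperateGrowth := by
    fun_prop
  have e : (lapSymbol : Rd d → ℂ) = ((-(2 * Real.pi) ^ 2 : ℝ) : ℂ) • fun ξ : Rd d => ((‖ξ‖ ^ 2 : ℝ) : ℂ) := by
    ext ξ; simp [lapSymbol]; ring
  rw [laplacian_eq_fourierMultiplierCLM, e, fourierMultiplierCLM_smul h,
    _root_.smul_apply, Complex.coe_smul]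

theorem multiplier_eq_toDist_iff {u g : Rd d → ℝ} (hu : MemLp u 2 volume) (hg : MemLp g 2 volume)
    {m : Rd d → ℂ} (hm : m.HasTemperateGrowth) :
    fourierMultiplierCLM ℂ m (toDist u) = toDist g ↔
      ft g =ᵐ[volume] fun ξ => m ξ * ft u ξ := by
  rw [toDist_eq hg, multiplier_eq_iff hu hm, ft_eq hg, ftL2]
  exact ⟨fun h => h.symm, fun h => h.symm⟩

theorem isL2Function_partialD_iff {u g : Rd d → ℝ} (hu : MemLp u 2 volume) (i : Fin d) :
    IsL2Function (partialD i (toDist u)) g ↔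
      MemLp g 2 volume ∧ ft g =ᵐ[volume] fun ξ => dSymbol i ξ * ft u ξ := by
  unfold IsL2Function
  apply and_congr_right
  intro hg
  rw [partialD_eq, multiplier_eq_toDist_iff hu hg (dSymbol_growth i)]

theorem isLaplacian_iff {u ℓ : Rd d → ℝ} (hu : MemLp u 2 volume) :
    IsLaplacian u ℓ ↔ MemLp ℓ 2 volume ∧ ft ℓ =ᵐ[volume] fun ξ => lapSymbol ξ * ft u ξ := by
  unfold IsLaplacian IsL2Function
  apply and_congr_right
  intro hg
  rw [laplacian_eq, multiplier_eq_toDist_iff hu hg lapSymbol_growth]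

theorem norm_dSymbol (i : Fin d) (ξ : Rd d) : ‖dSymbol i ξ‖ = 2 * Real.pi * |ξ i| := by
  simp [dSymbol, abs_of_pos Real.pi_pos]

theorem sum_norm_dSymbol_sq (ξ : Rd d) : ∑ i, ‖dSymbol i ξ‖ ^ 2 = (2 * Real.pi * ‖ξ‖) ^ 2 := by
  simp_rw [norm_dSymbol, mul_pow, sq_abs]
  rw [← Finset.mul_sum, EuclideanSpace.real_norm_sq_eq]

theorem norm_dSymbol_le (i : Fin d) (ξ : Rd d) : ‖dSymbol i ξ‖ ≤ 2 * Real.pi * ‖ξ‖ := by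
  apply le_of_sq_le_sq _ (by positivity)
  rw [← sum_norm_dSymbol_sq]
  exact Finset.single_le_sum (f := fun i => ‖dSymbol i ξ‖ ^ 2) (fun j _ => by positivity)
    (Finset.mem_univ i)

theorem eLpNorm_two_sq {E : Type*} [NormedAddCommGroup E] (f : Rd d → E) :
    eLpNorm f 2 volume ^ 2 = ∫⁻ x, ‖f x‖ₑ ^ 2 := by
  have := eLpNorm_nnreal_pow_eq_lintegral (μ := (volume : Measure (Rd d))) (f := f) (p := 2)
    (by norm_num)
  simpa using this

/-- The extended norm `|Λʳ ∇u|₂`, computed on the Fourier side. -/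
def gradSob (r : ℝ) (u : Rd d → ℝ) : ℝ≥0∞ :=
  eLpNorm (fun ξ => ((lamSymbol r ξ * (2 * Real.pi * ‖ξ‖) : ℝ) : ℂ) * ft u ξ) 2 volume

/-- The squared symbols of the ∂ᵢ add up to |2πξ|², so the sum over components collapses to a single
weighted L² norm of û. -/
theorem lamGradNorm_eq {u : Rd d → ℝ} (hu : MemLp u 2 volume) (r : ℝ) :
    lamGradNorm r u = gradSob r u := by
  have h (i : Fin d) : l2Norm (Lam r (partialD i (toDist u))) ^ 2 =
      ∫⁻ ξ, ‖dSymbol i ξ * lamSymbol r ξ * ft u ξ‖ₑ ^ 2 := by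
    rw [partialD_eq, Lam, fourierMultiplierCLM_fourierMultiplierCLM_apply (dSymbol_growth i)
      (lamSymbol_complex_growth r), l2Norm_multiplier hu
      ((dSymbol_growth i).mul (lamSymbol_complex_growth r)), eLpNorm_two_sq]
    rfl
  have h2 : ∑ i : Fin d, l2Norm (Lam r (partialD i (toDist u))) ^ 2 = gradSob r u ^ 2 := by
    simp_rw [h]
    rw [gradSob, eLpNorm_two_sq, ← lintegral_finsetSum']
    · congr 1
      ext ξ
      have e1 (i : Fin d) : ‖dSymbol i ξ * lamSymbol r ξ * ft u ξ‖ₑ ^ 2 =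
          ENNReal.ofReal (‖dSymbol i ξ‖ ^ 2 * (lamSymbol r ξ * ‖ft u ξ‖) ^ 2) := by
        rw [← ofReal_norm, ← ENNReal.ofReal_pow (norm_nonneg _), norm_mul, norm_mul,
          Complex.norm_real, Real.norm_of_nonneg (lamSymbol_pos r ξ).le]
        congr 1; ring
      simp_rw [e1]
      rw [← ENNReal.ofReal_sum_of_nonneg (fun i _ => by positivity), ← Finset.sum_mul,
        sum_norm_dSymbol_sq, ← ofReal_norm, ← ENNReal.ofReal_pow (norm_nonneg _), norm_mul,
        Complex.norm_real, Real.norm_of_nonneg (by have := lamSymbol_pos r ξ; positivity)]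
      congr 1; ring
    · intro i _
      have h1 := (dSymbol_growth i).1.continuous
      have h2 := (lamSymbol_complex_growth (d := d) r).1.continuous
      exact (((h1.mul h2).aestronglyMeasurable.mul (aestronglyMeasurable_ft u)).enorm.pow_const 2)
  rw [lamGradNorm, h2, ← ENNReal.rpow_natCast, ← ENNReal.rpow_mul]
  norm_num

theorem exists_ft_eq_symbol_mul {u : Rd d → ℝ} (hu : MemLp u 2 volume) {m : Rd d → ℂ}
    (hm : ∀ ξ, m (-ξ) = conj (m ξ)) (h : MemLp (fun ξ => m ξ * ft u ξ) 2 volume) :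
    ∃ g : Rd d → ℝ, MemLp g 2 volume ∧ ft g =ᵐ[volume] fun ξ => m ξ * ft u ξ := by
  apply exists_ft_eq h
  filter_upwards [ft_neg hu] with ξ hξ
  rw [hm, hξ, map_mul]

theorem dSymbol_neg (i : Fin d) (ξ : Rd d) : dSymbol i (-ξ) = conj (dSymbol i ξ) := by
  rw [dSymbol, dSymbol, map_mul, Complex.conj_ofReal, Complex.conj_I]
  simp

/-! ### Weak derivatives through difference quotients -/

/-- `g ∈ L²` is the weak partial derivative `∂ᵢ u` of `u ∈ L²`. -/
structure IsPartial (i : Fin d) (u g : Rd d → ℝ) : Prop where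
  memLp_fun : MemLp u 2 volume
  memLp : MemLp g 2 volume
  ft_eq : ft g =ᵐ[volume] fun ξ => dSymbol i ξ * ft u ξ

/-- The `k`-th difference quotient, of step `1 / (k + 1)`, in the direction `i`. -/
def diffQuot (i : Fin d) (k : ℕ) (u : Rd d → ℝ) (x : Rd d) : ℝ :=
  (k + 1 : ℝ) * (u (x + EuclideanSpace.single i ((k + 1 : ℝ)⁻¹)) - u x)

/-- The symbol of the difference quotient. -/
def dqSymbol (i : Fin d) (k : ℕ) (ξ : Rd d) : ℂ :=
  (k + 1 : ℝ) * (trSymbol (EuclideanSpace.single i ((k + 1 : ℝ)⁻¹)) ξ - 1)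

theorem dqSymbol_eq (i : Fin d) (k : ℕ) (ξ : Rd d) :
    dqSymbol i k ξ = (k + 1 : ℝ) *
      (Complex.exp (Complex.I * ((2 * Real.pi * ξ i * (k + 1 : ℝ)⁻¹ : ℝ) : ℂ)) - 1) := by
  rw [dqSymbol, trSymbol, EuclideanSpace.inner_single_left, mul_comm _ Complex.I]
  simp only [RCLike.conj_to_real]
  rw [mul_comm ((k + 1 : ℝ)⁻¹) (ξ i), ← mul_assoc (2 * Real.pi)]

/-- From |e^{iθ} - 1| ≤ |θ|. This domination yields both the uniform L² bound on difference
quotients and the majorants for dominated convergence. -/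
theorem norm_dqSymbol_le (i : Fin d) (k : ℕ) (ξ : Rd d) : ‖dqSymbol i k ξ‖ ≤ ‖dSymbol i ξ‖ := by
  rw [dqSymbol_eq, norm_mul, Complex.norm_real, norm_dSymbol, Real.norm_of_nonneg (by positivity)]
  have h := Real.norm_exp_I_mul_ofReal_sub_one_le (x := 2 * Real.pi * ξ i * (k + 1 : ℝ)⁻¹)
  rw [Real.norm_eq_abs, abs_mul, abs_mul, abs_mul, abs_of_pos Real.pi_pos, abs_two,
    abs_of_pos (by positivity : (0 : ℝ) < (k + 1 : ℝ)⁻¹)] at h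
  calc (k + 1 : ℝ) * _ ≤ (k + 1 : ℝ) * (2 * Real.pi * |ξ i| * (k + 1 : ℝ)⁻¹) := by gcongr
    _ = 2 * Real.pi * |ξ i| := by field_simp

theorem tendsto_natCast_add_one_inv : Tendsto (fun k : ℕ => (k + 1 : ℝ)⁻¹) atTop (𝓝 0) := by
  simpa [one_div] using tendsto_one_div_add_atTop_nhds_zero_nat (𝕜 := ℝ)

theorem tendsto_dqSymbol (i : Fin d) (ξ : Rd d) :
    Tendsto (fun k => dqSymbol i k ξ) atTop (𝓝 (dSymbol i ξ)) := by
  have hd : HasDerivAt (fun t : ℝ => Complex.exp (Complex.I * ((2 * Real.pi * ξ i * t : ℝ) : ℂ)))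
      (dSymbol i ξ) 0 := by
    have h1 : HasDerivAt (fun t : ℝ => ((2 * Real.pi * ξ i * t : ℝ) : ℂ))
        ((2 * Real.pi * ξ i : ℝ) : ℂ) 0 := by
      have := ((hasDerivAt_id (0 : ℝ)).const_mul (2 * Real.pi * ξ i)).ofReal_comp
      simpa using this
    have h2 := (h1.const_mul Complex.I).cexp
    convert h2 using 1
    simp [dSymbol]; ring
  have h := (hd.hasFDerivAt.hasFDerivWithinAt (s := Set.univ)).lim
    (c := fun k : ℕ => (k + 1 : ℝ)) (d := fun k : ℕ => (k + 1 : ℝ)⁻¹) (v := 1) (l := atTop)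
    tendsto_natCast_add_one_inv (by simp) (by
      apply tendsto_const_nhds.congr'
      filter_upwards with k
      have : (k + 1 : ℝ) ≠ 0 := by positivity
      simp [this])
  simp only [ContinuousLinearMap.toSpanSingleton_apply, one_smul] at h
  refine h.congr fun k => ?_
  rw [dqSymbol_eq]
  simp

theorem memLp_diffQuot {u : Rd d → ℝ} (hu : MemLp u 2 volume) (i : Fin d) (k : ℕ) :
    MemLp (diffQuot i k u) 2 volume :=
  ((memLp_translate hu _).sub hu).const_mul _

theorem ft_diffQuot {u : Rd d → ℝ} (hu : MemLp u 2 volume) (i : Fin d) (k : ℕ) :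
    ft (diffQuot i k u) =ᵐ[volume] fun ξ => dqSymbol i k ξ * ft u ξ := by
  have h1 := memLp_translate hu (EuclideanSpace.single i ((k + 1 : ℝ)⁻¹))
  have h2 := ft_const_mul (k + 1 : ℝ) (h1.sub hu)
  have h3 := ft_sub h1 hu
  filter_upwards [h2, h3, ft_translate hu (EuclideanSpace.single i ((k + 1 : ℝ)⁻¹))]
    with ξ h2 h3 h4
  rw [dqSymbol, mul_assoc, sub_mul, one_mul, ← h4, ← h3]
  exact h2

theorem continuous_dqSymbol (i : Fin d) (k : ℕ) : Continuous (dqSymbol i k : Rd d → ℂ) := by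
  have := continuous_trSymbol (EuclideanSpace.single i ((k + 1 : ℝ)⁻¹))
  unfold dqSymbol
  fun_prop

theorem continuous_dSymbol (i : Fin d) : Continuous (dSymbol i : Rd d → ℂ) :=
  (dSymbol_growth i).1.continuous

/-- Difference quotients converge in `L²` to the weak derivative. -/
theorem IsPartial.tendsto_diffQuot {i : Fin d} {u g : Rd d → ℝ} (h : IsPartial i u g) :
    Tendsto (fun k => eLpNorm (fun x => diffQuot i k u x - g x) 2 volume) atTop (𝓝 0) := by
  have e (k : ℕ) : eLpNorm (fun x => diffQuot i k u x - g x) 2 volume ^ 2 =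
      ∫⁻ ξ, ‖(dqSymbol i k ξ - dSymbol i ξ) * ft u ξ‖ₑ ^ 2 := by
    have h1 : MemLp (fun x => diffQuot i k u x - g x) 2 volume :=
      (memLp_diffQuot h.memLp_fun i k).sub h.memLp
    rw [← eLpNorm_ft h1, eLpNorm_two_sq]
    apply lintegral_congr_ae
    filter_upwards [ft_sub (memLp_diffQuot h.memLp_fun i k) h.memLp,
      ft_diffQuot h.memLp_fun i k, h.ft_eq] with ξ h1 h2 h3
    rw [h1, h2, h3, sub_mul]
  have hgm : MemLp (fun ξ => dSymbol i ξ * ft u ξ) 2 volume :=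
    (memLp_congr_ae h.ft_eq).1 (memLp_ft g)
  have hlim : Tendsto (fun k => ∫⁻ ξ, ‖(dqSymbol i k ξ - dSymbol i ξ) * ft u ξ‖ₑ ^ 2) atTop
      (𝓝 (∫⁻ _ : Rd d, 0)) := by
    -- The majorant 2|∂ᵢ-symbol · û| comes from the triangle inequality and `norm_dqSymbol_le`.
    apply tendsto_lintegral_of_dominated_convergence'
      (fun ξ => ‖(2 : ℂ) * (dSymbol i ξ * ft u ξ)‖ₑ ^ 2)
    · intro k
      exact ((((continuous_dqSymbol i k).sub (continuous_dSymbol i)).aestronglyMeasurable.mul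
        (aestronglyMeasurable_ft u)).enorm.pow_const 2)
    · intro k
      filter_upwards with ξ
      gcongr
      rw [enorm_le_iff_norm_le, norm_mul, norm_mul, norm_mul, ← mul_assoc]
      gcongr
      calc _ ≤ ‖dqSymbol i k ξ‖ + ‖dSymbol i ξ‖ := norm_sub_le _ _
        _ ≤ ‖(2 : ℂ)‖ * ‖dSymbol i ξ‖ := by
          have := norm_dqSymbol_le i k ξ
          simp; linarith
    · rw [← eLpNorm_two_sq]
      exact (ENNReal.pow_lt_top (hgm.const_mul 2).2).ne
    · filter_upwards with ξ
      have h1 : Tendsto (fun k => (dqSymbol i k ξ - dSymbol i ξ) * ft u ξ) atTop (𝓝 0) := by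
        have := ((tendsto_dqSymbol i ξ).sub_const (dSymbol i ξ)).mul_const (ft u ξ)
        simpa using this
      have h2 := (ENNReal.continuous_pow 2).tendsto _ |>.comp ((continuous_enorm.tendsto _).comp h1)
      simpa [Function.comp_def] using h2
  simp_rw [← e] at hlim
  rw [lintegral_zero] at hlim
  have := ((ENNReal.continuous_rpow_const (y := 1 / 2)).tendsto _).comp hlim
  simp only [Function.comp_def, ← ENNReal.rpow_natCast, ← ENNReal.rpow_mul] at this
  simpa using this

theorem eLpNorm_diffQuot_le {i : Fin d} {u : Rd d → ℝ} (hu : MemLp u 2 volume) (k : ℕ) :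
    eLpNorm (diffQuot i k u) 2 volume ≤ eLpNorm (fun ξ => dSymbol i ξ * ft u ξ) 2 volume := by
  rw [← eLpNorm_ft (memLp_diffQuot hu i k), eLpNorm_congr_ae (ft_diffQuot hu i k)]
  apply eLpNorm_mono
  intro ξ
  rw [norm_mul, norm_mul]
  gcongr
  exact norm_dqSymbol_le i k ξ

theorem ae_translate {p : Rd d → Prop} (h : ∀ᵐ x, p x) (a : Rd d) : ∀ᵐ x, p (x + a) :=
  (measurePreserving_add_right volume a).quasiMeasurePreserving.ae h

/-- A Lipschitz function of an `H¹` function is `H¹`. -/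
theorem eLpNorm_dSymbol_comp_le {i : Fin d} {u v : Rd d → ℝ} (hu : MemLp u 2 volume)
    (hv : MemLp v 2 volume) {T : ℝ → ℝ} {S : Set ℝ} {L : ℝ≥0∞} (hS : ∀ᵐ x, u x ∈ S)
    (hT : ∀ a ∈ S, ∀ b ∈ S, ‖T a - T b‖ₑ ≤ L * ‖a - b‖ₑ) (hvT : ∀ᵐ x, v x = T (u x)) :
    eLpNorm (fun ξ => dSymbol i ξ * ft v ξ) 2 volume ≤
      L * eLpNorm (fun ξ => dSymbol i ξ * ft u ξ) 2 volume := by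
  have h1 (k : ℕ) : eLpNorm (fun ξ => dqSymbol i k ξ * ft v ξ) 2 volume ≤
      L * eLpNorm (fun ξ => dSymbol i ξ * ft u ξ) 2 volume := by
    rw [← eLpNorm_congr_ae (ft_diffQuot hv i k), eLpNorm_ft (memLp_diffQuot hv i k)]
    refine le_trans ?_ (mul_le_mul_right (eLpNorm_diffQuot_le hu k) L)
    apply eLpNorm_le_mul_eLpNorm_of_ae_le_mul'' _ (memLp_diffQuot hu i k).1
    filter_upwards [hS, hvT, ae_translate hS (EuclideanSpace.single i ((k + 1 : ℝ)⁻¹)),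
      ae_translate hvT (EuclideanSpace.single i ((k + 1 : ℝ)⁻¹))] with x h1 h2 h3 h4
    rw [diffQuot, diffQuot, h2, h4, enorm_mul, enorm_mul, mul_left_comm]
    gcongr
    exact hT _ h3 _ h1
  -- The bound for quotients is uniform in the step; since the symbols converge pointwise, Fatou's
  -- lemma passes it to ∂ᵢ.
  refine (Lp.eLpNorm_lim_le_liminf_eLpNorm (f := fun k ξ => dqSymbol i k ξ * ft v ξ) (fun k =>
    ((continuous_dqSymbol i k).aestronglyMeasurable.mul (aestronglyMeasurable_ft v))) _
    (.of_forall fun ξ => (tendsto_dqSymbol i ξ).mul_const _)).trans ?_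
  refine (liminf_le_liminf (.of_forall h1)).trans ?_
  simp

theorem IsPartial.memLp_symbol {i : Fin d} {u g : Rd d → ℝ} (h : IsPartial i u g) :
    MemLp (fun ξ => dSymbol i ξ * ft u ξ) 2 volume :=
  (memLp_congr_ae h.ft_eq).1 (memLp_ft g)

theorem exists_isPartial {i : Fin d} {u : Rd d → ℝ} (hu : MemLp u 2 volume)
    (h : eLpNorm (fun ξ => dSymbol i ξ * ft u ξ) 2 volume < ∞) : ∃ g, IsPartial i u g := by
  obtain ⟨g, hg, hg'⟩ := exists_ft_eq_symbol_mul hu (dSymbol_neg i)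
    ((memLp_symbol_mul_iff (continuous_dSymbol i)).2 h)
  exact ⟨g, hu, hg, hg'⟩

theorem IsPartial.exists_subseq {i : Fin d} {u g : Rd d → ℝ} (h : IsPartial i u g)
    {ns : ℕ → ℕ} (hns : Tendsto ns atTop atTop) :
    ∃ ms : ℕ → ℕ, StrictMono ms ∧
      ∀ᵐ x, Tendsto (fun k => diffQuot i (ns (ms k)) u x) atTop (𝓝 (g x)) := by
  have h1 : TendstoInMeasure volume (fun k => diffQuot i (ns k) u) atTop g :=
    tendstoInMeasure_of_tendsto_eLpNorm (p := 2) (by norm_num)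
      (fun k => (memLp_diffQuot h.memLp_fun i _).1) h.memLp.1 (h.tendsto_diffQuot.comp hns)
  exact h1.exists_seq_tendsto_ae

/-- The chain rule for weak derivatives. -/
theorem IsPartial.comp {i : Fin d} {u g v h : Rd d → ℝ} (hu : IsPartial i u g)
    (hv : IsPartial i v h) {T T' : ℝ → ℝ} (hT : ∀ t, HasDerivAt T (T' t) t)
    (hvT : ∀ᵐ x, v x = T (u x)) : ∀ᵐ x, h x = T' (u x) * g x := by
  -- Two successive extractions make the quotients of u and of v converge almost everywhere along
  -- the same steps. At such a point only the classical differentiability of T at u x is needed.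
  obtain ⟨ns, hns, h1⟩ := hu.exists_subseq tendsto_id
  obtain ⟨ms, hms, h2⟩ := hv.exists_subseq hns.tendsto_atTop
  have htr : ∀ᵐ x, ∀ k : ℕ, v (x + EuclideanSpace.single i ((k + 1 : ℝ)⁻¹)) =
      T (u (x + EuclideanSpace.single i ((k + 1 : ℝ)⁻¹))) :=
    ae_all_iff.2 fun k => ae_translate hvT _
  filter_upwards [h1, h2, hvT, htr] with x h1 h2 h3 h4
  have h5 : Tendsto (fun k => diffQuot i (ns (ms k)) u x) atTop (𝓝 (g x)) :=
    h1.comp hms.tendsto_atTop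
  have h0 : Tendsto (fun k : ℕ => u (x + EuclideanSpace.single i ((ns (ms k) + 1 : ℝ)⁻¹)) - u x)
      atTop (𝓝 0) := by
    have h := (tendsto_natCast_add_one_inv.comp
      (hns.tendsto_atTop.comp hms.tendsto_atTop)).mul h5
    rw [zero_mul] at h
    refine h.congr fun k => ?_
    have : (ns (ms k) + 1 : ℝ) ≠ 0 := by positivity
    simp only [Function.comp_apply, diffQuot]
    field_simp
  -- The increments u(x + h) - u(x) serve as the increments of T's argument: they tend to 0, and
  -- rescaled by the inverse step they tend to g x.
  have h6 := ((hT (u x)).hasFDerivAt.hasFDerivWithinAt (s := Set.univ)).lim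
    (c := fun k : ℕ => (ns (ms k) + 1 : ℝ))
    (d := fun k : ℕ => u (x + EuclideanSpace.single i ((ns (ms k) + 1 : ℝ)⁻¹)) - u x)
    (v := g x) (l := atTop) h0 (by simp) h5
  have h7 : Tendsto (fun k => diffQuot i (ns (ms k)) v x) atTop (𝓝 (T' (u x) * g x)) := by
    rw [ContinuousLinearMap.toSpanSingleton_apply, smul_eq_mul, mul_comm] at h6
    refine h6.congr fun k => ?_
    rw [diffQuot, h3, h4, smul_eq_mul, add_sub_cancel]
  exact tendsto_nhds_unique h2 h7

/-! ### Integration by parts and monotonicity of the Laplacian -/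

theorem integrable_ft_mul_ft (u v : Rd d → ℝ) :
    Integrable (fun ξ => (ft u ξ * conj (ft v ξ)).re) volume :=
  ((memLp_ft u).integrable_mul (memLp_ft v).star).re

/-- The pairing `⟨-Δu, v⟩` as the sum of the pairings of partial derivatives. -/
theorem integral_partial_mul {i : Fin d} {u v g h : Rd d → ℝ} (hu : IsPartial i u g)
    (hv : IsPartial i v h) :
    ∫ x, g x * h x = ∫ ξ, ‖dSymbol i ξ‖ ^ 2 * (ft u ξ * conj (ft v ξ)).re := by
  rw [integral_mul_eq_ft hu.memLp hv.memLp]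
  apply integral_congr_ae
  filter_upwards [hu.ft_eq, hv.ft_eq] with ξ h1 h2
  rw [h1, h2, map_mul, mul_mul_mul_comm, Complex.mul_conj, Complex.re_ofReal_mul,
    Complex.normSq_eq_norm_sq]

/-- No derivative of v is required: since |2πξᵢ|² ≤ |2πξ|², each integrand is dominated by that of
the pairing of ℓ with v, which is integrable. This lets the monotonicity lemma test with functions
known only to be in L². -/
theorem integral_lap_mul {u v ℓ : Rd d → ℝ} (hv : MemLp v 2 volume) (hℓ : MemLp ℓ 2 volume)
    (h : ft ℓ =ᵐ[volume] fun ξ => lapSymbol ξ * ft u ξ) :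
    (∀ i, Integrable (fun ξ => ‖dSymbol i ξ‖ ^ 2 * (ft u ξ * conj (ft v ξ)).re) volume) ∧
    ∑ i, ∫ ξ, ‖dSymbol i ξ‖ ^ 2 * (ft u ξ * conj (ft v ξ)).re = -∫ x, ℓ x * v x := by
  have hint (i : Fin d) :
      Integrable (fun ξ => ‖dSymbol i ξ‖ ^ 2 * (ft u ξ * conj (ft v ξ)).re) volume := by
    have h1 : Integrable (fun ξ => ft ℓ ξ * conj (ft v ξ)) volume :=
      (memLp_ft ℓ).integrable_mul (memLp_ft v).star
    refine h1.mono ?_ ?_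
    · exact ((continuous_dSymbol i).norm.pow 2).aestronglyMeasurable.mul
        (integrable_ft_mul_ft u v).1
    · filter_upwards [h] with ξ hξ
      rw [hξ, norm_mul, norm_mul, norm_mul, lapSymbol, Complex.norm_real, norm_neg, mul_assoc,
        ← norm_mul (ft u ξ)]
      gcongr
      · rw [norm_pow, norm_pow, norm_norm, Real.norm_of_nonneg (by positivity)]
        gcongr
        exact norm_dSymbol_le i ξ
      · exact Complex.abs_re_le_norm _
  refine ⟨hint, ?_⟩
  rw [← integral_finsetSum _ (fun i _ => hint i), integral_mul_eq_ft hℓ hv, ← integral_neg]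
  apply integral_congr_ae
  filter_upwards [h] with ξ hξ
  rw [← Finset.sum_mul, sum_norm_dSymbol_sq, hξ, mul_assoc (lapSymbol ξ), lapSymbol, Complex.re_ofReal_mul]
  ring

/-- Green's formula on the whole space. There is no boundary term to discard, since both sides are
the same integral on the Fourier side. -/
theorem sum_integral_partial_mul {u v ℓ : Rd d → ℝ} {G H : Fin d → Rd d → ℝ}
    (hu : ∀ i, IsPartial i u (G i)) (hv : ∀ i, IsPartial i v (H i)) (hvL : MemLp v 2 volume)
    (hℓ : MemLp ℓ 2 volume)
    (h : ft ℓ =ᵐ[volume] fun ξ => lapSymbol ξ * ft u ξ) :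
    ∑ i, ∫ x, G i x * H i x = -∫ x, ℓ x * v x := by
  rw [← (integral_lap_mul hvL hℓ h).2]
  exact Finset.sum_congr rfl fun i _ => integral_partial_mul (hu i) (hv i)

/-- Monotonicity of `-Δ`: `⟨-Δu, T(u)⟩ ≥ 0` for every nondecreasing `T`. -/
theorem integral_lap_mul_comp_nonpos {u v ℓ : Rd d → ℝ} (hu : MemLp u 2 volume)
    (hv : MemLp v 2 volume) (hℓ : MemLp ℓ 2 volume)
    (h : ft ℓ =ᵐ[volume] fun ξ => lapSymbol ξ * ft u ξ) {T : ℝ → ℝ} (hT : Monotone T)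
    (hvT : ∀ᵐ x, v x = T (u x)) : ∫ x, ℓ x * v x ≤ 0 := by
  obtain ⟨hint, hsum⟩ := integral_lap_mul hv hℓ h
  suffices H : ∀ i, 0 ≤ ∫ ξ, ‖dSymbol i ξ‖ ^ 2 * (ft u ξ * conj (ft v ξ)).re by
    have := Finset.sum_nonneg fun i (_ : i ∈ Finset.univ) => H i
    linarith
  intro i
  -- For a quotient the claim is pointwise: the increments of u and of T(u) have the same sign.
  -- Parseval moves this to the Fourier side, where dominated convergence in k is available.
  have h1 (k : ℕ) : 0 ≤ ∫ ξ, ‖dqSymbol i k ξ‖ ^ 2 * (ft u ξ * conj (ft v ξ)).re := by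
    have e : ∫ x, diffQuot i k u x * diffQuot i k v x =
        ∫ ξ, ‖dqSymbol i k ξ‖ ^ 2 * (ft u ξ * conj (ft v ξ)).re := by
      rw [integral_mul_eq_ft (memLp_diffQuot hu i k) (memLp_diffQuot hv i k)]
      apply integral_congr_ae
      filter_upwards [ft_diffQuot hu i k, ft_diffQuot hv i k] with ξ h1 h2
      rw [h1, h2, map_mul, mul_mul_mul_comm, Complex.mul_conj, Complex.re_ofReal_mul,
        Complex.normSq_eq_norm_sq]
    rw [← e]
    apply integral_nonneg_of_ae
    filter_upwards [hvT, ae_translate hvT (EuclideanSpace.single i ((k + 1 : ℝ)⁻¹))] with x h1 h2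
    rw [diffQuot, diffQuot, h1, h2, mul_mul_mul_comm]
    refine mul_nonneg (mul_self_nonneg _) ?_
    rcases le_total (u x) (u (x + EuclideanSpace.single i ((k + 1 : ℝ)⁻¹))) with h | h
    · exact mul_nonneg (by linarith) (by linarith [hT h])
    · exact mul_nonneg_of_nonpos_of_nonpos (by linarith) (by linarith [hT h])
  refine ge_of_tendsto (x := atTop) (tendsto_integral_of_dominated_convergence _ (fun k => ?_)
    (hint i).norm (fun k => ?_) (.of_forall fun ξ => ?_)) (.of_forall h1)
  · exact ((continuous_dqSymbol i k).norm.pow 2).aestronglyMeasurable.mul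
      (integrable_ft_mul_ft u v).1
  · filter_upwards with ξ
    rw [norm_mul, norm_mul, norm_pow, norm_pow, norm_norm, norm_norm]
    gcongr
    exact norm_dqSymbol_le i k ξ
  · exact ((tendsto_dqSymbol i ξ).norm.pow 2).mul_const _

/-! ### Weighted convolution inequalities -/

theorem lintegral_mul_sq_le {f g : Rd d → ℝ≥0∞} (hf : AEMeasurable f volume)
    (hg : AEMeasurable g volume) :
    (∫⁻ x, f x * g x) ^ 2 ≤ (∫⁻ x, f x ^ 2) * ∫⁻ x, g x ^ 2 := by
  have h := ENNReal.lintegral_mul_le_Lp_mul_Lq volume Real.HolderConjugate.two_two hf hg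
  simp only [Pi.mul_apply, ENNReal.rpow_ofNat] at h
  calc _ ≤ ((∫⁻ x, f x ^ 2) ^ (1 / 2 : ℝ) * (∫⁻ x, g x ^ 2) ^ (1 / 2 : ℝ)) ^ 2 := by gcongr
    _ = _ := by
      rw [mul_pow, ← ENNReal.rpow_natCast, ← ENNReal.rpow_natCast, ← ENNReal.rpow_mul,
        ← ENNReal.rpow_mul]
      norm_num

theorem aemeasurable_sub_left {A : Rd d → ℝ≥0∞} (hA : AEMeasurable A volume) (ξ : Rd d) :
    AEMeasurable (fun η => A (ξ - η)) volume :=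
  hA.comp_quasiMeasurePreserving (quasiMeasurePreserving_sub_left volume ξ)

/-- Cauchy–Schwarz in η isolates the kernel, whose squared integral is at most κ uniformly in ξ;
Tonelli and translation invariance then factor what remains. -/
theorem lintegral_conv_sq_le {A B k₁ k₂ : Rd d → ℝ≥0∞} (hA : AEMeasurable A volume)
    (hB : AEMeasurable B volume) (hk₁ : AEMeasurable k₁ volume) (hk₂ : AEMeasurable k₂ volume)
    {κ : ℝ≥0∞} (hk : ∀ ξ, ∫⁻ η, (k₁ (ξ - η) * k₂ η) ^ 2 ≤ κ) :
    ∫⁻ ξ, (∫⁻ η, A (ξ - η) * B η * (k₁ (ξ - η) * k₂ η)) ^ 2 ≤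
      κ * ((∫⁻ ξ, A ξ ^ 2) * ∫⁻ ξ, B ξ ^ 2) := by
  have h1 : AEMeasurable (Function.uncurry fun ξ η : Rd d => (A (ξ - η) * B η) ^ 2)
      (volume.prod volume) :=
    ((hA.comp_quasiMeasurePreserving (quasiMeasurePreserving_sub_of_right_invariant volume volume)).mul
      hB.comp_snd).pow_const 2
  calc _ ≤ ∫⁻ ξ, (∫⁻ η, (A (ξ - η) * B η) ^ 2) * κ := by
        gcongr with ξ
        refine (lintegral_mul_sq_le ((aemeasurable_sub_left hA ξ).mul hB)
          ((aemeasurable_sub_left hk₁ ξ).mul hk₂)).trans ?_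
        exact mul_le_mul' le_rfl (hk ξ)
    _ = (∫⁻ ξ, ∫⁻ η, (A (ξ - η) * B η) ^ 2) * κ :=
        lintegral_mul_const'' _ (h1.lintegral_prod_right')
    _ = (∫⁻ η, ∫⁻ ξ, (A (ξ - η) * B η) ^ 2) * κ := by rw [lintegral_lintegral_swap h1]
    _ = (∫⁻ η, (∫⁻ ξ, A ξ ^ 2) * B η ^ 2) * κ := by
        congr 2
        ext η
        simp_rw [mul_pow]
        have hm : AEMeasurable (fun ξ => A (ξ - η) ^ 2) volume :=
          (hA.comp_quasiMeasurePreserving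
            (measurePreserving_sub_right volume η).quasiMeasurePreserving).pow_const 2
        rw [lintegral_mul_const'' _ hm, lintegral_sub_right_eq_self (fun ξ => A ξ ^ 2)]
    _ = _ := by
        rw [lintegral_const_mul'' _ (hB.pow_const 2), mul_comm]

/-- The weight `⟨ξ⟩ˢ` with values in `[0, ∞]`. -/
def wt (s : ℝ) (ξ : Rd d) : ℝ≥0∞ := ENNReal.ofReal (lamSymbol s ξ)

theorem measurable_wt (s : ℝ) : Measurable (wt s : Rd d → ℝ≥0∞) :=
  ENNReal.measurable_ofReal.comp (continuous_lamSymbol s).measurable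

theorem wt_add (s t : ℝ) (ξ : Rd d) : wt (s + t) ξ = wt s ξ * wt t ξ := by
  rw [wt, wt, wt, lamSymbol_add, ENNReal.ofReal_mul (lamSymbol_pos s ξ).le]

theorem wt_zero (ξ : Rd d) : wt 0 ξ = 1 := by simp [wt, lamSymbol_zero]

theorem wt_mul_neg (s : ℝ) (ξ : Rd d) : wt s ξ * wt (-s) ξ = 1 := by
  rw [← wt_add, add_neg_cancel, wt_zero]

theorem sob_sq (s : ℝ) (u : Rd d → ℝ) : sob s u ^ 2 = ∫⁻ ξ, (wt s ξ * ‖ft u ξ‖ₑ) ^ 2 := by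
  rw [sob, eLpNorm_two_sq]
  congr 1
  ext ξ
  rw [enorm_mul, ← ofReal_norm, Complex.norm_real, Real.norm_of_nonneg (lamSymbol_pos s ξ).le, wt]

/-- `∫ ⟨ξ⟩⁻⁴`, finite in dimension at most three. -/
def kap (d : ℕ) : ℝ≥0∞ := ∫⁻ ξ : Rd d, wt (-4) ξ

/-- The restriction to dimension at most three enters here: ⟨ξ⟩⁻⁴ is integrable when 4 > d. -/
theorem kap_lt_top (hd : d ≤ 3) : kap d < ∞ := by
  have h : Integrable (fun ξ : Rd d => ((1 : ℝ) + ‖ξ‖ ^ 2) ^ (-4 / 2 : ℝ)) volume := by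
    apply integrable_rpow_neg_one_add_norm_sq
    rw [finrank_euclideanSpace_fin]
    exact_mod_cast (by omega : d < 4)
  refine lt_of_le_of_lt (lintegral_mono fun ξ => ?_) h.lintegral_lt_top
  apply ENNReal.ofReal_le_ofReal
  apply Real.rpow_le_rpow_of_nonpos (by positivity) _ (by norm_num)
  gcongr
  nlinarith [norm_nonneg ξ, Real.pi_gt_three]

theorem wt_sq (s : ℝ) (ξ : Rd d) : wt s ξ ^ 2 = wt (2 * s) ξ := by
  rw [sq, ← wt_add]; congr 1; ring

/-- The quasi-subadditivity of the weight. -/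
theorem wt_le {s : ℝ} (hs : 0 ≤ s) (ξ η : Rd d) :
    wt s ξ ≤ ENNReal.ofReal (2 ^ s) * (wt s (ξ - η) + wt s η) := by
  rw [wt, wt, wt, ← ENNReal.ofReal_add (lamSymbol_pos _ _).le (lamSymbol_pos _ _).le,
    ← ENNReal.ofReal_mul (by positivity)]
  apply ENNReal.ofReal_le_ofReal
  -- The larger of the two frequencies is at least half of |ξ|, and 1 + 4y² ≤ 4(1 + y²).
  have key : ∀ x y z : ℝ, 0 ≤ x → 0 ≤ y → 0 ≤ z → z ≤ x + y → x ≤ y →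
      (1 + z ^ 2) ^ (s / 2) ≤ 2 ^ s * ((1 + y ^ 2) ^ (s / 2)) := by
    intro x y z hx hy hz h hxy
    have e : (2 : ℝ) ^ s = 4 ^ (s / 2) := by
      rw [show (4 : ℝ) = 2 ^ (2 : ℝ) by norm_num, ← Real.rpow_mul (by norm_num)]
      congr 1; ring
    rw [e, ← Real.mul_rpow (by norm_num) (by positivity)]
    gcongr
    nlinarith
  have htri : ‖ξ‖ ≤ ‖ξ - η‖ + ‖η‖ := by simpa using norm_add_le (ξ - η) η
  have hpi := Real.pi_pos
  have htri' : 2 * Real.pi * ‖ξ‖ ≤ 2 * Real.pi * ‖ξ - η‖ + 2 * Real.pi * ‖η‖ := by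
    rw [← mul_add]; gcongr
  have p1 := lamSymbol_pos s (ξ - η)
  have p2 := lamSymbol_pos s η
  have p3 : (0 : ℝ) < 2 ^ s := by positivity
  rcases le_total (2 * Real.pi * ‖ξ - η‖) (2 * Real.pi * ‖η‖) with h | h
  · have := key _ _ _ (by positivity) (by positivity) (by positivity) htri' h
    calc _ ≤ 2 ^ s * lamSymbol s η := this
      _ ≤ _ := by gcongr; linarith
  · have := key _ _ _ (by positivity) (by positivity) (by positivity) (htri'.trans (add_comm _ _).le) h
    calc _ ≤ 2 ^ s * lamSymbol s (ξ - η) := this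
      _ ≤ _ := by gcongr; linarith

/-- The tame convolution estimate in weighted `L²` spaces. -/
theorem lintegral_wt_conv_sq_le {s : ℝ} (hs : 0 ≤ s) {a b : Rd d → ℝ≥0∞}
    (ha : AEMeasurable a volume) (hb : AEMeasurable b volume) :
    ∫⁻ ξ, (wt s ξ * ∫⁻ η, a (ξ - η) * b η) ^ 2 ≤
      2 * ENNReal.ofReal (2 ^ s) ^ 2 * kap d *
        ((∫⁻ ξ, (wt s ξ * a ξ) ^ 2) * (∫⁻ ξ, (wt 2 ξ * b ξ) ^ 2) +
          (∫⁻ ξ, (wt 1 ξ * a ξ) ^ 2) * (∫⁻ ξ, (wt (s + 1) ξ * b ξ) ^ 2)) := by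
  have hw (t : ℝ) : AEMeasurable (wt t : Rd d → ℝ≥0∞) volume := (measurable_wt t).aemeasurable
  set K := ENNReal.ofReal (2 ^ s)
  -- When the weight falls on a, two extra derivatives on b pay for the kernel ⟨η⟩⁻². When it falls
  -- on b, one extra derivative on each factor pays for ⟨ξ-η⟩⁻¹⟨η⟩⁻¹. Both kernels have squared
  -- integral at most `kap d`, the second by another Cauchy–Schwarz. Thus a is measured below level
  -- s only in H¹, all that is known of e^φ - 1 at the start.
  let T₁ : Rd d → ℝ≥0∞ := fun ξ =>
    ∫⁻ η, (wt s (ξ - η) * a (ξ - η)) * (wt 2 η * b η) * (1 * wt (-2) η)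
  let T₂ : Rd d → ℝ≥0∞ := fun ξ =>
    ∫⁻ η, (wt 1 (ξ - η) * a (ξ - η)) * (wt (s + 1) η * b η) * (wt (-1) (ξ - η) * wt (-1) η)
  have h1 : ∫⁻ ξ, T₁ ξ ^ 2 ≤
      kap d * ((∫⁻ ξ, (wt s ξ * a ξ) ^ 2) * ∫⁻ ξ, (wt 2 ξ * b ξ) ^ 2) := by
    apply lintegral_conv_sq_le (k₁ := fun _ => 1) ((hw s).mul ha) ((hw 2).mul hb)
      aemeasurable_const (hw (-2))
    intro ξ
    simp_rw [one_mul, wt_sq]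
    rw [kap]; norm_num
  have h2 : ∫⁻ ξ, T₂ ξ ^ 2 ≤
      kap d * ((∫⁻ ξ, (wt 1 ξ * a ξ) ^ 2) * ∫⁻ ξ, (wt (s + 1) ξ * b ξ) ^ 2) := by
    apply lintegral_conv_sq_le ((hw 1).mul ha) ((hw (s + 1)).mul hb) (hw (-1)) (hw (-1))
    intro ξ
    have e : ∫⁻ η, wt (-4) (ξ - η) = kap d := lintegral_sub_left_eq_self (wt (-4)) ξ
    simp_rw [mul_pow, wt_sq]
    have h3 := lintegral_mul_sq_le (aemeasurable_sub_left (hw (2 * -1)) ξ) (hw (2 * -1))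
    simp_rw [wt_sq] at h3
    norm_num at h3 ⊢
    rw [e, ← kap, ← sq] at h3
    exact (ENNReal.pow_le_pow_left_iff two_ne_zero).1 h3
  have hpt (ξ : Rd d) : wt s ξ * ∫⁻ η, a (ξ - η) * b η ≤ K * (T₁ ξ + T₂ ξ) := by
    have hmeas : AEMeasurable (fun η => (wt s (ξ - η) * a (ξ - η)) * (wt 2 η * b η) *
        (1 * wt (-2) η)) volume :=
      (((aemeasurable_sub_left (hw s) ξ).mul (aemeasurable_sub_left ha ξ)).mul
        ((hw 2).mul hb)).mul ((hw (-2)).const_mul 1)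
    rw [← lintegral_add_left' hmeas,
      ← lintegral_const_mul' _ _ ENNReal.ofReal_ne_top]
    have hws : wt s ξ ≠ ∞ := ENNReal.ofReal_ne_top
    rw [← lintegral_const_mul' _ _ hws]
    apply lintegral_mono
    intro η
    have e1 : (wt s (ξ - η) * a (ξ - η)) * (wt 2 η * b η) * (1 * wt (-2) η) =
        wt s (ξ - η) * (a (ξ - η) * b η) := by
      calc _ = wt s (ξ - η) * (a (ξ - η) * b η) * (wt 2 η * wt (-2) η) := by ring
        _ = _ := by rw [wt_mul_neg, mul_one]
    have e2 : (wt 1 (ξ - η) * a (ξ - η)) * (wt (s + 1) η * b η) *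
        (wt (-1) (ξ - η) * wt (-1) η) = wt s η * (a (ξ - η) * b η) := by
      rw [wt_add]
      calc _ = wt s η * (a (ξ - η) * b η) * (wt 1 (ξ - η) * wt (-1) (ξ - η)) *
            (wt 1 η * wt (-1) η) := by ring
        _ = _ := by rw [wt_mul_neg, wt_mul_neg, mul_one, mul_one]
    dsimp only
    rw [e1, e2, ← add_mul]
    exact (mul_le_mul' (wt_le hs ξ η) le_rfl).trans_eq (mul_assoc _ _ _)
  have hT₁ : AEMeasurable T₁ volume := by
    have : AEMeasurable (Function.uncurry fun ξ η : Rd d =>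
        (wt s (ξ - η) * a (ξ - η)) * (wt 2 η * b η) * (1 * wt (-2) η)) (volume.prod volume) :=
      ((((hw s).mul ha).comp_quasiMeasurePreserving
        (quasiMeasurePreserving_sub_of_right_invariant volume volume)).mul
        ((hw 2).mul hb).comp_snd).mul ((hw (-2)).comp_snd.const_mul 1)
    exact this.lintegral_prod_right'
  calc _ ≤ ∫⁻ ξ, (2 * K ^ 2) * (T₁ ξ ^ 2 + T₂ ξ ^ 2) := by
        apply lintegral_mono
        intro ξ
        refine (pow_le_pow_left₀ (zero_le) (hpt ξ) 2).trans ?_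
        dsimp only
        rw [mul_pow, mul_comm 2 (K ^ 2), mul_assoc]
        gcongr
        have := ENNReal.rpow_add_le_mul_rpow_add_rpow (T₁ ξ) (T₂ ξ) (p := 2) (by norm_num)
        norm_num at this
        exact this
    _ = 2 * K ^ 2 * (∫⁻ ξ, T₁ ξ ^ 2 + T₂ ξ ^ 2) :=
        lintegral_const_mul' _ _ (ENNReal.mul_ne_top (by norm_num)
          (ENNReal.pow_ne_top ENNReal.ofReal_ne_top))
    _ = 2 * K ^ 2 * ((∫⁻ ξ, T₁ ξ ^ 2) + ∫⁻ ξ, T₂ ξ ^ 2) := by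
        rw [lintegral_add_left' (hT₁.pow_const 2)]
    _ ≤ 2 * K ^ 2 * (kap d * ((∫⁻ ξ, (wt s ξ * a ξ) ^ 2) * ∫⁻ ξ, (wt 2 ξ * b ξ) ^ 2) +
          kap d * ((∫⁻ ξ, (wt 1 ξ * a ξ) ^ 2) * ∫⁻ ξ, (wt (s + 1) ξ * b ξ) ^ 2)) := by gcongr
    _ = _ := by ring

/-! ### The Fourier transform of a product -/

/-- Cauchy–Schwarz against ⟨ξ⟩⁻², whose square has integral `kap d`. -/
theorem integrable_ft_of_sob_two (hd : d ≤ 3) {g : Rd d → ℝ} (hg : sob 2 g < ∞) :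
    Integrable (ft g) volume := by
  refine ⟨aestronglyMeasurable_ft g, ?_⟩
  rw [hasFiniteIntegral_iff_enorm]
  have hm : AEMeasurable (fun ξ => ‖ft g ξ‖ₑ) volume := (aestronglyMeasurable_ft g).enorm
  have h := lintegral_mul_sq_le (((measurable_wt 2).aemeasurable).mul hm)
    ((measurable_wt (-2)).aemeasurable (μ := (volume : Measure (Rd d))))
  have e (ξ : Rd d) : wt 2 ξ * ‖ft g ξ‖ₑ * wt (-2) ξ = ‖ft g ξ‖ₑ := by
    rw [mul_right_comm, wt_mul_neg, one_mul]
  simp only [Pi.mul_apply, e, wt_sq] at h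
  rw [← sob_sq, show (2 * -2 : ℝ) = -4 by norm_num, ← kap] at h
  have h2 := h.trans_lt (ENNReal.mul_lt_top (ENNReal.pow_lt_top hg) (kap_lt_top hd))
  by_contra h3
  rw [not_lt_top_iff.1 h3] at h2
  simp at h2

theorem integral_fourierInv_mul_eq {f g : Rd d → ℂ} (hf : Integrable f volume)
    (hg : Integrable g volume) : ∫ ξ, 𝓕⁻ f ξ * g ξ = ∫ x, f x * 𝓕⁻ g x := by
  have h := VectorFourier.integral_fourierIntegral_smul_eq_flip (L := innerₗ (Rd d))
    Real.continuous_fourierChar continuous_inner hf.comp_neg hg.comp_neg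
  have e1 (f : Rd d → ℂ) (x : Rd d) : 𝓕⁻ f x = 𝓕 (fun y => f (-y)) x := by
    rw [Real.fourierInv_eq_fourier_comp_neg]
  have e2 : ∫ ξ, 𝓕⁻ f ξ * g ξ = ∫ ξ, 𝓕 f ξ * g (-ξ) := by
    rw [← integral_neg_eq_self]
    simp [Real.fourierInv_eq_fourier_neg]
  have e3 : ∫ x, f x * 𝓕⁻ g x = ∫ x, f x * 𝓕 (fun y => g (-y)) x := by
    simp_rw [e1 g]
  rw [e2, e3]
  have h' := VectorFourier.integral_fourierIntegral_smul_eq_flip (L := innerₗ (Rd d))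
    Real.continuous_fourierChar continuous_inner hf hg.comp_neg
  rw [flip_innerₗ] at h'
  exact h'

/-- Fourier inversion for functions with integrable Fourier transform. -/
theorem ae_eq_fourierInv_ft {g : Rd d → ℝ} (hg : MemLp g 2 volume)
    (hi : Integrable (ft g) volume) : (fun x => (g x : ℂ)) =ᵐ[volume] 𝓕⁻ (ft g) := by
  have hc : Continuous (𝓕⁻ (ft g)) := by
    have : 𝓕⁻ (ft g) = fun x => 𝓕 (ft g) (-x) := by
      ext x; rw [Real.fourierInv_eq_fourier_neg]
    rw [this]
    exact (VectorFourier.fourierIntegral_continuous Real.continuous_fourierChar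
      continuous_inner hi).comp continuous_neg
  apply ae_eq_of_forall_schwartz
  · exact (hg.ofReal (K := ℂ)).locallyIntegrable_two
  · exact hc.locallyIntegrable
  intro θ
  have h1 := integral_schwartz_mul_ft hg (𝓕⁻ θ)
  rw [FourierTransform.fourier_fourierInv_eq] at h1
  rw [← h1, ← integral_fourierInv_mul_eq θ.integrable hi, SchwartzMap.fourierInv_coe]

/-- The convolution of the Fourier transforms of `f` and `g`. -/
def ftConv (f g : Rd d → ℝ) (ξ : Rd d) : ℂ := ∫ η, ft f (ξ - η) * ft g η

theorem enorm_ftConv_le (f g : Rd d → ℝ) (ξ : Rd d) :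
    ‖ftConv f g ξ‖ₑ ≤ ∫⁻ η, ‖ft f (ξ - η)‖ₑ * ‖ft g η‖ₑ := by
  refine (enorm_integral_le_lintegral_enorm _).trans ?_
  simp_rw [enorm_mul]
  exact le_rfl

theorem aestronglyMeasurable_prod_ft (f g : Rd d → ℝ) :
    AEStronglyMeasurable (fun p : Rd d × Rd d => ft f (p.1 - p.2) * ft g p.2)
      (volume.prod volume) :=
  ((aestronglyMeasurable_ft f).comp_quasiMeasurePreserving
    (quasiMeasurePreserving_sub_of_right_invariant volume volume)).mul
    (aestronglyMeasurable_ft g).comp_snd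

theorem sobolev_ftConv_sq_le {s : ℝ} (hs : 0 ≤ s) (f g : Rd d → ℝ) :
    ∫⁻ ξ, (wt s ξ * ‖ftConv f g ξ‖ₑ) ^ 2 ≤ 2 * ENNReal.ofReal (2 ^ s) ^ 2 * kap d *
      (sob s f ^ 2 * sob 2 g ^ 2 + sob 1 f ^ 2 * sob (s + 1) g ^ 2) := by
  have h := lintegral_wt_conv_sq_le hs (aestronglyMeasurable_ft f).enorm
    (aestronglyMeasurable_ft g).enorm
  simp_rw [← sob_sq] at h
  refine le_trans (lintegral_mono fun ξ => ?_) h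
  dsimp only
  gcongr
  exact enorm_ftConv_le f g ξ

theorem sob_mono {s t : ℝ} (h : s ≤ t) (u : Rd d → ℝ) : sob s u ≤ sob t u := by
  apply eLpNorm_mono
  intro ξ
  rw [norm_mul, norm_mul, Complex.norm_real, Complex.norm_real,
    Real.norm_of_nonneg (lamSymbol_pos s ξ).le, Real.norm_of_nonneg (lamSymbol_pos t ξ).le]
  gcongr
  exact lamSymbol_mono h ξ

theorem memLp_ftConv (hd : d ≤ 3) {f g : Rd d → ℝ} (hf : sob 1 f < ∞) (hg : sob 2 g < ∞) :
    MemLp (ftConv f g) 2 volume := by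
  refine ⟨(aestronglyMeasurable_prod_ft f g).integral_prod_right', ?_⟩
  have h := sobolev_ftConv_sq_le le_rfl f g
  simp_rw [wt_zero, one_mul] at h
  rw [← eLpNorm_two_sq] at h
  have h0 : sob 0 f < ∞ := (sob_mono zero_le_one f).trans_lt hf
  have h1 : sob (0 + 1) g < ∞ := (sob_mono (by norm_num) g).trans_lt hg
  have hk := kap_lt_top hd
  have h2 : eLpNorm (ftConv f g) 2 volume ^ 2 < ∞ := by
    refine h.trans_lt ?_
    refine ENNReal.mul_lt_top (ENNReal.mul_lt_top (ENNReal.mul_lt_top (by norm_num)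
      (ENNReal.pow_lt_top ENNReal.ofReal_lt_top)) hk) ?_
    exact ENNReal.add_lt_top.2 ⟨ENNReal.mul_lt_top (ENNReal.pow_lt_top h0) (ENNReal.pow_lt_top hg),
      ENNReal.mul_lt_top (ENNReal.pow_lt_top hf) (ENNReal.pow_lt_top h1)⟩
  by_contra h3
  rw [not_lt_top_iff.1 h3] at h2
  simp at h2

/-- Only g needs an integrable transform. Fourier inversion replaces g by the inverse transform of ĝ
in the pairing with θ̂, the multiplication formula moves that inverse transform onto θ̂ f, where it
becomes the integral of θ(ξ) f̂(ξ-η), and Fubini reassembles the convolution. -/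
theorem ft_mul (hd : d ≤ 3) {f g : Rd d → ℝ} (hf : MemLp f 2 volume) (hg : MemLp g 2 volume)
    (hfg : MemLp (fun x => f x * g x) 2 volume) (hf1 : sob 1 f < ∞) (hg2 : sob 2 g < ∞) :
    ft (fun x => f x * g x) =ᵐ[volume] ftConv f g := by
  have hgi := integrable_ft_of_sob_two hd hg2
  apply ae_eq_of_forall_schwartz (memLp_ft _).locallyIntegrable_two
    (memLp_ftConv hd hf1 hg2).locallyIntegrable_two
  intro θ
  rw [integral_schwartz_mul_ft hfg]
  have hθ : MemLp θ 2 volume := θ.memLp 2 volume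
  have hFθ : MemLp (fun x => 𝓕 θ x) 2 volume := (𝓕 θ).memLp 2 volume
  have hfθ : Integrable (fun x => 𝓕 θ x * (f x : ℂ)) volume :=
    hFθ.integrable_mul (hf.ofReal (K := ℂ))
  have e1 : ∫ x, 𝓕 θ x * ((f x * g x : ℝ) : ℂ) =
      ∫ η, 𝓕⁻ (fun x => 𝓕 θ x * (f x : ℂ)) η * ft g η := by
    rw [integral_fourierInv_mul_eq hfθ hgi]
    apply integral_congr_ae
    filter_upwards [ae_eq_fourierInv_ft hg hgi] with x hx
    rw [← hx]; push_cast; ring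
  have e2 (η : Rd d) : 𝓕⁻ (fun x => 𝓕 θ x * (f x : ℂ)) η = ∫ ξ, θ ξ * ft f (ξ - η) := by
    have h1 := integral_schwartz_mul_ft hf (θ.compSubConstCLM ℂ (-η))
    rw [← integral_add_right_eq_self _ (-η)] at h1
    have h2 : ∫ ξ, θ ξ * ft f (ξ - η) =
        ∫ ξ, (θ.compSubConstCLM ℂ (-η)) (ξ + -η) * ft f (ξ + -η) := by
      congr 1; ext ξ
      simp [SchwartzMap.compSubConstCLM_apply, sub_eq_add_neg]
    rw [h2, h1, Real.fourierInv_eq']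
    congr 1
    ext x
    rw [fourier_compSubConst, smul_eq_mul, ← mul_assoc, inner_neg_left, real_inner_comm]
    congr 5
    ring
  rw [e1]
  simp_rw [e2]
  have hswap : Integrable (Function.uncurry fun ξ η : Rd d => θ ξ * ft f (ξ - η) * ft g η)
      (volume.prod volume) := by
    have hmeas : AEStronglyMeasurable
        (Function.uncurry fun ξ η : Rd d => θ ξ * ft f (ξ - η) * ft g η) (volume.prod volume) := by
      have := hθ.1.comp_fst (ν := (volume : Measure (Rd d)))|>.mul (aestronglyMeasurable_prod_ft f g)
      refine this.congr (.of_forall fun p => ?_)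
      simp only [Function.uncurry, Pi.mul_apply]
      ring
    refine ⟨hmeas, ?_⟩
    rw [hasFiniteIntegral_iff_enorm, lintegral_prod_symm _ hmeas.enorm]
    have hb (η : Rd d) : ∫⁻ ξ, ‖Function.uncurry (fun ξ η : Rd d => θ ξ * ft f (ξ - η) * ft g η)
        (ξ, η)‖ₑ ≤ (eLpNorm θ 2 volume * eLpNorm (ft f) 2 volume) * ‖ft g η‖ₑ := by
      simp only [Function.uncurry, enorm_mul]
      have hmp := measurePreserving_sub_right (volume : Measure (Rd d)) η
      have hm : AEStronglyMeasurable (fun ξ => ft f (ξ - η)) volume :=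
        (aestronglyMeasurable_ft f).comp_measurePreserving hmp
      have hm' : AEMeasurable (fun ξ => ‖θ ξ‖ₑ * ‖ft f (ξ - η)‖ₑ) volume :=
        hθ.1.enorm.mul hm.enorm
      rw [lintegral_mul_const'' _ hm']
      gcongr
      rw [← ENNReal.pow_le_pow_left_iff two_ne_zero, mul_pow]
      refine (lintegral_mul_sq_le hθ.1.enorm hm.enorm).trans ?_
      have hn := eLpNorm_comp_measurePreserving (p := 2) (aestronglyMeasurable_ft f) hmp
      rw [← eLpNorm_two_sq, ← eLpNorm_two_sq, ← hn]
      rfl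
    refine (lintegral_mono hb).trans_lt ?_
    rw [lintegral_const_mul'' _ (aestronglyMeasurable_ft g).enorm]
    exact ENNReal.mul_lt_top (ENNReal.mul_lt_top hθ.2 (memLp_ft f).2) hgi.2
  have e3 : ∫ ξ, θ ξ * ftConv f g ξ = ∫ ξ, ∫ η, θ ξ * ft f (ξ - η) * ft g η := by
    congr 1; ext ξ
    rw [ftConv, ← integral_const_mul]
    simp_rw [mul_assoc]
  rw [e3, integral_integral_swap hswap]
  congr 1; ext η
  rw [integral_mul_const]

/-- The tame product estimate in dimension at most three. -/
theorem exists_sob_mul_le (hd : d ≤ 3) {s : ℝ} (hs : 0 ≤ s) :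
    ∃ C : ℝ≥0, ∀ f g : Rd d → ℝ, MemLp f 2 volume → MemLp g 2 volume →
      MemLp (fun x => f x * g x) 2 volume → sob 1 f < ∞ → sob 2 g < ∞ →
      sob s (fun x => f x * g x) ≤ C * (sob s f * sob 2 g + sob 1 f * sob (s + 1) g) := by
  set M := 2 * ENNReal.ofReal (2 ^ s) ^ 2 * kap d with hM
  have hMt : M ≠ ∞ := (ENNReal.mul_lt_top (ENNReal.mul_lt_top (by norm_num)
      (ENNReal.pow_lt_top ENNReal.ofReal_lt_top)) (kap_lt_top hd)).ne
  -- The convolution estimate is for squares. Taking M + 1 as constant avoids a square root, since M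
  -- ≤ (M + 1)² and x² + y² ≤ (x + y)².
  refine ⟨M.toNNReal + 1, fun f g hf hg hfg hf1 hg2 => ?_⟩
  rw [← ENNReal.pow_le_pow_left_iff two_ne_zero, sob_sq]
  have e : ∫⁻ ξ, (wt s ξ * ‖ft (fun x => f x * g x) ξ‖ₑ) ^ 2 =
      ∫⁻ ξ, (wt s ξ * ‖ftConv f g ξ‖ₑ) ^ 2 := by
    apply lintegral_congr_ae
    filter_upwards [ft_mul hd hf hg hfg hf1 hg2] with ξ hξ
    rw [hξ]
  rw [e]
  refine (sobolev_ftConv_sq_le hs f g).trans ?_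
  rw [mul_pow, ENNReal.coe_add, ENNReal.coe_toNNReal hMt, ENNReal.coe_one]
  gcongr
  · calc M ≤ M + 1 := le_self_add
      _ = (M + 1) * 1 := (mul_one _).symm
      _ ≤ (M + 1) * (M + 1) := by gcongr; exact le_add_self
      _ = _ := (sq _).symm
  · rw [← mul_pow, ← mul_pow, add_sq]
    exact add_le_add_left le_self_add _

/-! ### Existence and uniqueness -/

/-- The symbol of the resolvent `(K - Δ)⁻¹`. -/
def resSymbol (K : ℝ) (ξ : Rd d) : ℂ := (((K + (2 * Real.pi * ‖ξ‖) ^ 2)⁻¹ : ℝ) : ℂ)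

theorem resSymbol_neg (K : ℝ) (ξ : Rd d) : resSymbol K (-ξ) = conj (resSymbol K ξ) := by
  rw [resSymbol, resSymbol, Complex.conj_ofReal, norm_neg]

theorem norm_resSymbol_le {K : ℝ} (hK : 0 < K) (ξ : Rd d) : ‖resSymbol K ξ‖ ≤ K⁻¹ := by
  rw [resSymbol, Complex.norm_real, Real.norm_of_nonneg (by positivity)]
  gcongr
  nlinarith [sq_nonneg (2 * Real.pi * ‖ξ‖)]

theorem continuous_resSymbol {K : ℝ} (hK : 0 < K) : Continuous (resSymbol K : Rd d → ℂ) := by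
  unfold resSymbol
  apply Complex.continuous_ofReal.comp
  apply Continuous.inv₀ (by fun_prop)
  intro ξ
  positivity

/-- The symbol is real, even and at most 1/K, so (K - Δ)⁻¹ preserves real functions and has norm at
most 1/K on L². -/
theorem exists_resolvent {K : ℝ} (hK : 0 < K) :
    ∃ R : Lp ℝ 2 (volume : Measure (Rd d)) → Lp ℝ 2 (volume : Measure (Rd d)),
      (∀ f, ft (R f) =ᵐ[volume] fun ξ => resSymbol K ξ * ft f ξ) ∧
      ∀ f g, ‖R f - R g‖ ≤ K⁻¹ * ‖f - g‖ := by
  have h (f : Lp ℝ 2 (volume : Measure (Rd d))) : ∃ u : Lp ℝ 2 (volume : Measure (Rd d)),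
      ft u =ᵐ[volume] fun ξ => resSymbol K ξ * ft f ξ := by
    obtain ⟨u, hu, hu'⟩ := exists_ft_eq_symbol_mul (Lp.memLp f) (resSymbol_neg K)
      (memLp_bounded_mul (memLp_ft f) (continuous_resSymbol hK).aestronglyMeasurable K⁻¹
        (.of_forall (norm_resSymbol_le hK)))
    exact ⟨hu.toLp u, by rw [ft_congr hu.coeFn_toLp]; exact hu'⟩
  choose R hR using h
  refine ⟨R, hR, fun f g => ?_⟩
  have e1 : ft (R f - R g : Lp ℝ 2 (volume : Measure (Rd d))) =ᵐ[volume]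
      fun ξ => resSymbol K ξ * ft (f - g : Lp ℝ 2 (volume : Measure (Rd d))) ξ := by
    rw [ft_congr (Lp.coeFn_sub (R f) (R g)), ft_congr (Lp.coeFn_sub f g)]
    filter_upwards [hR f, hR g, ft_sub (Lp.memLp (R f)) (Lp.memLp (R g)),
      ft_sub (Lp.memLp f) (Lp.memLp g)] with ξ h1 h2 h3 h4
    have h3' : ft (⇑(R f) - ⇑(R g)) ξ = ft (R f) ξ - ft (R g) ξ := h3
    have h4' : ft (⇑f - ⇑g) ξ = ft f ξ - ft g ξ := h4
    rw [h3', h4', h1, h2, mul_sub]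
  have e2 : eLpNorm (R f - R g : Lp ℝ 2 (volume : Measure (Rd d))) 2 volume ≤
      ENNReal.ofReal K⁻¹ * eLpNorm (f - g : Lp ℝ 2 (volume : Measure (Rd d))) 2 volume := by
    rw [← eLpNorm_ft (Lp.memLp (R f - R g)), ← eLpNorm_ft (Lp.memLp (f - g)), eLpNorm_congr_ae e1]
    apply eLpNorm_le_mul_eLpNorm_of_ae_le_mul
    filter_upwards with ξ
    rw [norm_mul]
    gcongr
    exact norm_resSymbol_le hK ξ
  rw [Lp.norm_def, Lp.norm_def]
  have h3 := ENNReal.toReal_mono (ENNReal.mul_ne_top ENNReal.ofReal_ne_top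
    (Lp.eLpNorm_ne_top (f - g))) e2
  rwa [ENNReal.toReal_mul, ENNReal.toReal_ofReal (by positivity)] at h3

/-- Solvability of `-Δφ + g(φ) = n` for a nonlinearity with slopes in `[c, K]`. -/
theorem exists_solution_of_slopes {c K : ℝ} (hc : 0 < c) (hcK : c ≤ K) {g : ℝ → ℝ} (hg0 : g 0 = 0)
    (hg : ∀ s t, s ≤ t → c * (t - s) ≤ g t - g s ∧ g t - g s ≤ K * (t - s))
    {n : Rd d → ℝ} (hn : MemLp n 2 volume) :
    ∃ φ : Rd d → ℝ, MemLp φ 2 volume ∧ MemLp (fun x => g (φ x) - n x) 2 volume ∧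
      ft (fun x => g (φ x) - n x) =ᵐ[volume] fun ξ => lapSymbol ξ * ft φ ξ := by
  have hK : 0 < K := hc.trans_le hcK
  obtain ⟨R, hR, hRn⟩ := exists_resolvent (d := d) hK
  -- The equation reads (K - Δ)φ = h(φ) + n. The slopes of h lie in [0, K - c], so composing with
  -- the resolvent gives the contraction factor (K - c)/K < 1.
  let h : ℝ → ℝ := fun t => K * t - g t
  have hh0 : h 0 = 0 := by simp [h, hg0]
  have hlip : LipschitzWith (K - c).toNNReal h := by
    apply LipschitzWith.of_dist_le_mul
    have key : ∀ s t, s ≤ t → |h t - h s| ≤ (K - c) * |t - s| := by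
      intro s t hst
      obtain ⟨h1, h2⟩ := hg s t hst
      have e : h t - h s = K * (t - s) - (g t - g s) := by simp only [h]; ring
      rw [e, abs_of_nonneg (by linarith), abs_of_nonneg (by linarith)]
      linarith
    intro s t
    rw [Real.coe_toNNReal _ (by linarith), Real.dist_eq, Real.dist_eq]
    rcases le_total s t with hst | hst
    · rw [abs_sub_comm, abs_sub_comm s t]; exact key s t hst
    · exact key t s hst
  let Φ : Lp ℝ 2 (volume : Measure (Rd d)) → Lp ℝ 2 (volume : Measure (Rd d)) :=
    fun u => R (hlip.compLp hh0 u + hn.toLp n)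
  have hΦ : ContractingWith (K⁻¹ * (K - c)).toNNReal Φ := by
    constructor
    · rw [← NNReal.coe_lt_coe, Real.coe_toNNReal _ (mul_nonneg (by positivity) (by linarith)),
        NNReal.coe_one, inv_mul_lt_iff₀ hK]
      linarith
    · apply LipschitzWith.of_dist_le_mul
      intro u v
      rw [Real.coe_toNNReal _ (mul_nonneg (by positivity) (by linarith)), dist_eq_norm,
        dist_eq_norm]
      refine (hRn _ _).trans ?_
      rw [add_sub_add_right_eq_sub, mul_assoc]
      gcongr
      have := hlip.norm_compLp_sub_le hh0 u v
      rwa [Real.coe_toNNReal _ (by linarith)] at this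
  let φ := hΦ.fixedPoint Φ
  have hfix : Φ φ = φ := hΦ.fixedPoint_isFixedPt
  have hφ : MemLp φ 2 volume := Lp.memLp _
  let f : Lp ℝ 2 (volume : Measure (Rd d)) := hlip.compLp hh0 φ + hn.toLp n
  have hf : MemLp f 2 volume := Lp.memLp _
  have hft : ft φ =ᵐ[volume] fun ξ => resSymbol K ξ * ft f ξ := by
    have := hR f
    rwa [show R f = φ from hfix] at this
  have he : (fun x => K * φ x - f x) =ᵐ[volume] fun x => g (φ x) - n x := by
    filter_upwards [Lp.coeFn_add (hlip.compLp hh0 φ) (hn.toLp n), hlip.coeFn_compLp hh0 φ,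
      hn.coeFn_toLp] with x h1 h2 h3
    rw [h1, Pi.add_apply, h2, h3]
    simp only [h, Function.comp_apply]
    ring
  have hKφ : MemLp (fun x => K * φ x) 2 volume := hφ.const_mul K
  refine ⟨φ, hφ, (memLp_congr_ae he).1 (hKφ.sub hf), ?_⟩
  rw [← ft_congr he]
  filter_upwards [ft_sub hKφ hf, ft_const_mul K hφ, hft] with ξ h1 h2 h3
  rw [h1, h2, h3, resSymbol, lapSymbol]
  have hp : ((K + (2 * Real.pi * ‖ξ‖) ^ 2 : ℝ) : ℂ) ≠ 0 := by
    exact_mod_cast (by positivity : K + (2 * Real.pi * ‖ξ‖) ^ 2 ≠ 0)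
  have hq := mul_inv_cancel₀ hp
  rw [Complex.ofReal_inv]
  push_cast at hq ⊢
  linear_combination ft f ξ * hq

theorem memLp_comp_of_abs_le {u : Rd d → ℝ} (hu : MemLp u 2 volume) {T : ℝ → ℝ}
    (hT : Continuous T) {L : ℝ} (h : ∀ᵐ x, |T (u x)| ≤ L * |u x|) :
    MemLp (fun x => T (u x)) 2 volume :=
  hu.of_le_mul (c := L) (hT.comp_aestronglyMeasurable hu.1) h

/-- Existence for `-Δφ + e^φ - 1 = n`, together with the maximum principle. -/
theorem exists_solution {c b : ℝ} (hc : 0 < c) (hc1 : c ≤ 1) (hb : 0 ≤ b) {n : Rd d → ℝ}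
    (hn : MemLp n 2 volume) (hcn : ∀ᵐ x, c ≤ 1 + n x) (hbn : ∀ᵐ x, n x ≤ b) :
    ∃ φ : Rd d → ℝ, MemLp φ 2 volume ∧
      MemLp (fun x => Real.exp (φ x) - 1 - n x) 2 volume ∧
      ft (fun x => Real.exp (φ x) - 1 - n x) =ᵐ[volume] (fun ξ => lapSymbol ξ * ft φ ξ) ∧
      ∀ᵐ x, Real.log c ≤ φ x ∧ φ x ≤ Real.log (1 + b) := by
  set α := Real.log c with hα
  set β := Real.log (1 + b) with hβ
  have hα0 : α ≤ 0 := Real.log_nonpos hc.le hc1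
  have hβ0 : 0 ≤ β := Real.log_nonneg (by linarith)
  have heα : Real.exp α = c := Real.exp_log hc
  have heβ : Real.exp β = 1 + b := Real.exp_log (by linarith)
  -- cl is the projection onto [α, β] and T the excess. The function g equals e^t - 1 on the
  -- interval and is affine of slope c outside it; a constant continuation would lose the coercivity
  -- that the contraction needs.
  let cl : ℝ → ℝ := fun t => max α (min t β)
  let T : ℝ → ℝ := fun t => t - cl t
  let g : ℝ → ℝ := fun t => Real.exp (cl t) - 1 + c * T t
  have hcl_mono : Monotone cl := fun s t h => max_le_max le_rfl (min_le_min h le_rfl)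
  have hclα (t) : α ≤ cl t := le_max_left _ _
  have hclβ (t) : cl t ≤ β := max_le (hα0.trans hβ0) (min_le_right _ _)
  have hcl_id (t) (h1 : α ≤ t) (h2 : t ≤ β) : cl t = t := by
    simp only [cl]; rw [min_eq_left h2, max_eq_right h1]
  have hcl_lo (t) (h1 : t ≤ α) : cl t = α := by
    simp only [cl]; rw [min_eq_left (by linarith), max_eq_left h1]
  have hcl_hi (t) (h1 : β ≤ t) : cl t = β := by
    simp only [cl]; rw [min_eq_right h1, max_eq_right (by linarith)]
  have hT_mono : Monotone T := by
    intro s t h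
    simp only [T, cl]
    rcases le_total t β with h1 | h1 <;> rcases le_total s β with h2 | h2 <;>
      simp only [min_eq_left, min_eq_right, h1, h2] <;>
      rcases le_total α t with h3 | h3 <;> rcases le_total α s with h4 | h4 <;>
      rcases le_total α β with h5 | h5 <;>
      simp only [max_eq_left, max_eq_right, h3, h4, h5] <;> linarith
  have hg0 : g 0 = 0 := by simp [g, T, hcl_id 0 hα0 hβ0]
  have hslope : ∀ s t, s ≤ t → c * (t - s) ≤ g t - g s ∧ g t - g s ≤ (1 + b) * (t - s) := by
    intro s t hst
    have h1 := hcl_mono hst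
    have h2 := hT_mono hst
    have h3 : c * (cl t - cl s) ≤ Real.exp (cl t) - Real.exp (cl s) := by
      have e1 : Real.exp (cl t) = Real.exp (cl s) * Real.exp (cl t - cl s) := by
        rw [← Real.exp_add]; congr 1; ring
      have e2 : c ≤ Real.exp (cl s) := heα ▸ Real.exp_le_exp.2 (hclα s)
      have e3 := Real.add_one_le_exp (cl t - cl s)
      rw [e1]
      nlinarith
    have h4 : Real.exp (cl t) - Real.exp (cl s) ≤ (1 + b) * (cl t - cl s) := by
      have e1 : Real.exp (cl s) = Real.exp (cl t) * Real.exp (cl s - cl t) := by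
        rw [← Real.exp_add]; congr 1; ring
      have e2 : Real.exp (cl t) ≤ 1 + b := heβ ▸ Real.exp_le_exp.2 (hclβ t)
      have e3 := Real.add_one_le_exp (cl s - cl t)
      have e4 := Real.exp_pos (cl t)
      rw [e1]
      nlinarith
    have e : t - s = (cl t - cl s) + (T t - T s) := by simp only [T]; ring
    simp only [g]
    constructor <;> rw [e] <;> nlinarith
  have hcl_cont : Continuous cl := by fun_prop
  have hT_cont : Continuous T := by fun_prop
  obtain ⟨φ, hφ, hℓ, hℓft⟩ := exists_solution_of_slopes hc (by linarith : c ≤ 1 + b) hg0 hslope hn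
  have hT0 : T 0 = 0 := by simp [T, hcl_id 0 hα0 hβ0]
  have hTabs (t : ℝ) : |T t| ≤ 1 * |t| := by
    rw [one_mul]
    have hc0 : cl 0 = 0 := hcl_id 0 hα0 hβ0
    rcases le_total 0 t with h | h
    · have h1 := hT_mono h
      have h2 := hcl_mono h
      rw [abs_of_nonneg (by linarith), abs_of_nonneg h]
      simp only [T] at *
      linarith
    · have h1 := hT_mono h
      have h2 := hcl_mono h
      rw [abs_of_nonpos (by linarith), abs_of_nonpos h]
      simp only [T] at *
      linarith
  have hTφ : MemLp (fun x => T (φ x)) 2 volume :=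
    memLp_comp_of_abs_le hφ hT_cont (.of_forall fun x => hTabs _)
  -- Maximum principle: the Laplacian tested with T(φ) is nonpositive, while pointwise the product
  -- is at least c T(φ)², because c - 1 ≤ n ≤ b. Hence T(φ) vanishes almost everywhere.
  have hmono := integral_lap_mul_comp_nonpos hφ hTφ hℓ hℓft hT_mono (.of_forall fun _ => rfl)
  have hint : Integrable (fun x => (g (φ x) - n x) * T (φ x)) volume := hℓ.integrable_mul hTφ
  have hpt : ∀ᵐ x, c * T (φ x) ^ 2 ≤ (g (φ x) - n x) * T (φ x) := by
    filter_upwards [hcn, hbn] with x h1 h2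
    rcases le_total (φ x) α with h | h
    · have e : g (φ x) = c - 1 + c * T (φ x) := by simp only [g]; rw [hcl_lo _ h, heα]
      have : T (φ x) ≤ 0 := by simp only [T]; rw [hcl_lo _ h]; linarith
      rw [e]; nlinarith
    · rcases le_total β (φ x) with h' | h'
      · have e : g (φ x) = b + c * T (φ x) := by simp only [g]; rw [hcl_hi _ h', heβ]; ring
        have : 0 ≤ T (φ x) := by simp only [T]; rw [hcl_hi _ h']; linarith
        rw [e]; nlinarith
      · have : T (φ x) = 0 := by simp only [T]; rw [hcl_id _ h h']; ring
        simp [this]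
  have hsq : Integrable (fun x => c * T (φ x) ^ 2) volume := hTφ.integrable_sq.const_mul c
  have hzero : ∀ᵐ x, T (φ x) = 0 := by
    have h0 : ∫ x, c * T (φ x) ^ 2 = 0 := by
      apply le_antisymm ((integral_mono_ae hsq hint hpt).trans hmono)
      exact integral_nonneg fun x => by positivity
    have := (integral_eq_zero_iff_of_nonneg (fun x => by positivity) hsq).1 h0
    filter_upwards [this] with x hx
    have : T (φ x) ^ 2 = 0 := by simpa [hc.ne'] using hx
    simpa using this
  have hbd : ∀ᵐ x, α ≤ φ x ∧ φ x ≤ β := by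
    filter_upwards [hzero] with x hx
    have e : φ x = cl (φ x) := by simp only [T] at hx; linarith
    exact ⟨e ▸ hclα _, e ▸ hclβ _⟩
  have hcongr : (fun x => g (φ x) - n x) =ᵐ[volume] fun x => Real.exp (φ x) - 1 - n x := by
    filter_upwards [hzero] with x hx
    have e : cl (φ x) = φ x := by simp only [T] at hx; linarith
    simp only [g, hx, e]; ring
  refine ⟨φ, hφ, (memLp_congr_ae hcongr).1 hℓ, ?_, hbd⟩
  rw [← ft_congr hcongr]
  exact hℓft

/-- Uniqueness of solutions of `-Δφ + e^φ - 1 = n` in `L²`. -/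
theorem solves_unique {n φ ψ : Rd d → ℝ} (hφ : MemLp φ 2 volume) (hψ : MemLp ψ 2 volume)
    (h1 : Solves n φ) (h2 : Solves n ψ) : ψ =ᵐ[volume] φ := by
  obtain ⟨ℓ, hℓ, hφn⟩ := h1
  obtain ⟨m, hm, hψn⟩ := h2
  obtain ⟨hℓ2, hℓft⟩ := (isLaplacian_iff hφ).1 hℓ
  obtain ⟨hm2, hmft⟩ := (isLaplacian_iff hψ).1 hm
  have hu : MemLp (fun x => ψ x - φ x) 2 volume := hψ.sub hφ
  have hl : MemLp (fun x => m x - ℓ x) 2 volume := hm2.sub hℓ2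
  have hft : ft (fun x => m x - ℓ x) =ᵐ[volume] fun ξ => lapSymbol ξ * ft (fun x => ψ x - φ x) ξ := by
    filter_upwards [ft_sub hm2 hℓ2, ft_sub hψ hφ, hℓft, hmft] with ξ h1 h2 h3 h4
    rw [h1, h2, h3, h4, mul_sub]
  -- Monotonicity with T the identity, against the strict monotonicity of exp.
  have hmono := integral_lap_mul_comp_nonpos hu hu hl hft monotone_id (.of_forall fun _ => rfl)
  have hint : Integrable (fun x => (m x - ℓ x) * (ψ x - φ x)) volume := hl.integrable_mul hu
  have hpt : ∀ᵐ x, 0 ≤ (m x - ℓ x) * (ψ x - φ x) ∧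
      ((m x - ℓ x) * (ψ x - φ x) = 0 → ψ x = φ x) := by
    filter_upwards [hφn, hψn] with x h1 h2
    have e : m x - ℓ x = Real.exp (ψ x) - Real.exp (φ x) := by linarith
    rw [e]
    rcases lt_trichotomy (ψ x) (φ x) with h | h | h
    · have := Real.exp_lt_exp.2 h
      have : 0 < (Real.exp (ψ x) - Real.exp (φ x)) * (ψ x - φ x) := by nlinarith
      exact ⟨this.le, fun h' => absurd h' this.ne'⟩
    · rw [h]; simp
    · have := Real.exp_lt_exp.2 h
      have : 0 < (Real.exp (ψ x) - Real.exp (φ x)) * (ψ x - φ x) := by nlinarith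
      exact ⟨this.le, fun h' => absurd h' this.ne'⟩
  have h0 : ∫ x, (m x - ℓ x) * (ψ x - φ x) = 0 :=
    le_antisymm hmono (integral_nonneg_of_ae (hpt.mono fun x h => h.1))
  have := (integral_eq_zero_iff_of_nonneg_ae (hpt.mono fun x h => h.1) hint).1 h0
  filter_upwards [hpt, this] with x h1 h2
  exact h1.2 h2

/-! ### Solutions in Fourier form and their first derivatives -/

theorem eLpNorm_sq_eq_ofReal {g : Rd d → ℝ} (hg : MemLp g 2 volume) :
    eLpNorm g 2 volume ^ 2 = ENNReal.ofReal (∫ x, g x ^ 2) := by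
  rw [eLpNorm_two_sq, ofReal_integral_eq_lintegral_ofReal hg.integrable_sq
    (.of_forall fun x => sq_nonneg _)]
  congr 1; ext x
  rw [← ofReal_norm, ← ENNReal.ofReal_pow (norm_nonneg _), Real.norm_eq_abs, sq_abs]

theorem eLpNorm_le_add {f : Rd d → ℂ} {g₁ g₂ : Rd d → ℂ} (h₁ : AEStronglyMeasurable g₁ volume)
    (h₂ : AEStronglyMeasurable g₂ volume) (h : ∀ᵐ x, ‖f x‖ ≤ ‖g₁ x‖ + ‖g₂ x‖) :
    eLpNorm f 2 volume ≤ eLpNorm g₁ 2 volume + eLpNorm g₂ 2 volume := by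
  rw [← eLpNorm_norm g₁, ← eLpNorm_norm g₂]
  refine le_trans ?_ (eLpNorm_add_le h₁.norm h₂.norm (by norm_num))
  apply eLpNorm_mono_ae
  filter_upwards [h] with x hx
  refine hx.trans (le_abs_self _)

theorem sob_zero (u : Rd d → ℝ) : sob 0 u = eLpNorm (ft u) 2 volume := by
  simp [sob, lamSymbol_zero]

theorem exists_isPartial_of_sob_one {u : Rd d → ℝ} (hu : MemLp u 2 volume) (h : sob 1 u < ∞)
    (i : Fin d) : ∃ g, IsPartial i u g := by
  apply exists_isPartial hu
  refine lt_of_le_of_lt (eLpNorm_mono fun ξ => ?_) h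
  rw [norm_mul, norm_mul, Complex.norm_real, Real.norm_of_nonneg (lamSymbol_pos 1 ξ).le]
  gcongr
  refine (norm_dSymbol_le i ξ).trans ?_
  apply le_of_sq_le_sq _ (lamSymbol_pos 1 ξ).le
  rw [lamSymbol_one_sq]
  linarith

/-- `φ` is a solution with data `n`, where `c ≤ 1 + n` and `n ≤ b`, in the weak formulation on the
Fourier side, with its pointwise bounds. -/
structure Sol (c b : ℝ) (n φ : Rd d → ℝ) : Prop where
  c_pos : 0 < c
  c_le_one : c ≤ 1
  b_nonneg : 0 ≤ b
  n_memLp : MemLp n 2 volume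
  n_sob : sob 1 n < ∞
  memLp : MemLp φ 2 volume
  lap_memLp : MemLp (fun x => Real.exp (φ x) - 1 - n x) 2 volume
  lap_ft : ft (fun x => Real.exp (φ x) - 1 - n x) =ᵐ[volume] fun ξ => lapSymbol ξ * ft φ ξ
  bounds : ∀ᵐ x, Real.log c ≤ φ x ∧ φ x ≤ Real.log (1 + b)

/-- The nonlinear term `e^φ - 1`. -/
def expm (φ : Rd d → ℝ) (x : Rd d) : ℝ := Real.exp (φ x) - 1

/-- The energy bound `|n|₂² / c + |n|_{H¹}²`. -/
def energyBound (c : ℝ) (n : Rd d → ℝ) : ℝ := 1 / c * (∫ x, n x ^ 2) + (sob 1 n).toReal ^ 2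

namespace Sol

variable {c b : ℝ} {n φ : Rd d → ℝ}

theorem expm_memLp (h : Sol c b n φ) : MemLp (expm φ) 2 volume := by
  have := h.lap_memLp.add h.n_memLp
  refine (memLp_congr_ae (.of_forall fun x => ?_)).1 this
  simp [expm]

/-- Interpolation between φ and Δφ: with r = 2π|ξ|, one has r ≤ 1 + r². -/
theorem exists_partial (h : Sol c b n φ) (i : Fin d) : ∃ g, IsPartial i φ g := by
  apply exists_isPartial h.memLp
  refine lt_of_le_of_lt (eLpNorm_le_add (aestronglyMeasurable_ft φ)
    (aestronglyMeasurable_ft (fun x => Real.exp (φ x) - 1 - n x)) ?_)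
    (ENNReal.add_lt_top.2 ⟨(memLp_ft φ).2, (memLp_ft _).2⟩)
  filter_upwards [h.lap_ft] with ξ hξ
  rw [hξ, norm_mul, norm_mul, lapSymbol, Complex.norm_real, norm_neg,
    Real.norm_of_nonneg (by positivity)]
  have := norm_dSymbol_le i ξ
  nlinarith [norm_nonneg (ft φ ξ), sq_nonneg (2 * Real.pi * ‖ξ‖ - 1),
    mul_le_mul_of_nonneg_right this (norm_nonneg (ft φ ξ)),
    mul_nonneg (norm_nonneg (ft φ ξ)) (sq_nonneg (2 * Real.pi * ‖ξ‖ - 1)),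
    mul_nonneg (norm_nonneg (ft φ ξ)) (sq_nonneg (2 * Real.pi * ‖ξ‖))]

theorem exp_le (h : Sol c b n φ) : ∀ᵐ x, c ≤ Real.exp (φ x) ∧ Real.exp (φ x) ≤ 1 + b := by
  filter_upwards [h.bounds] with x hx
  have hb := h.b_nonneg
  rw [← Real.exp_log h.c_pos, ← Real.exp_log (by linarith : 0 < 1 + b)]
  exact ⟨Real.exp_le_exp.2 hx.1, Real.exp_le_exp.2 hx.2⟩

theorem exp_lipschitz {β s t : ℝ} (hs : s ≤ β) (ht : t ≤ β) :
    |Real.exp s - Real.exp t| ≤ Real.exp β * |s - t| := by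
  have key : ∀ s t : ℝ, s ≤ t → t ≤ β → |Real.exp s - Real.exp t| ≤ Real.exp β * |s - t| := by
    intro s t hst ht
    rw [abs_of_nonpos (by linarith [Real.exp_le_exp.2 hst]), abs_of_nonpos (by linarith)]
    have e1 : Real.exp s = Real.exp t * Real.exp (s - t) := by rw [← Real.exp_add]; congr 1; ring
    have e3 := Real.add_one_le_exp (s - t)
    have e4 := Real.exp_pos t
    have e5 := Real.exp_le_exp.2 ht
    calc -(Real.exp s - Real.exp t) ≤ Real.exp t * (t - s) := by rw [e1]; nlinarith
      _ ≤ Real.exp β * -(s - t) := by nlinarith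
  rcases le_total s t with h | h
  · exact key s t h ht
  · rw [abs_sub_comm, abs_sub_comm s t]; exact key t s h hs

/-- The weak derivatives of `e^φ - 1` are `e^φ ∂ᵢφ`. -/
theorem isPartial_expm (h : Sol c b n φ) {i : Fin d} {g : Rd d → ℝ} (hg : IsPartial i φ g) :
    IsPartial i (expm φ) (fun x => Real.exp (φ x) * g x) := by
  -- The exponential is Lipschitz only on half-lines bounded above, so the upper bound on φ is what
  -- puts e^φ - 1 in H¹.
  obtain ⟨k, hk⟩ := exists_isPartial (i := i) h.expm_memLp (by
    refine lt_of_le_of_lt (eLpNorm_dSymbol_comp_le (i := i) h.memLp h.expm_memLp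
      (T := fun t => Real.exp t - 1) (S := Set.Iic (Real.log (1 + b)))
      (L := ENNReal.ofReal (Real.exp (Real.log (1 + b))))
      (h.bounds.mono fun x hx => hx.2) (fun s hs t ht => ?_) (.of_forall fun x => rfl)) ?_
    · rw [← ofReal_norm, ← ofReal_norm, ← ENNReal.ofReal_mul (Real.exp_pos _).le]
      apply ENNReal.ofReal_le_ofReal
      rw [Real.norm_eq_abs, Real.norm_eq_abs, sub_sub_sub_cancel_right]
      exact exp_lipschitz hs ht
    · exact ENNReal.mul_lt_top ENNReal.ofReal_lt_top hg.memLp_symbol.2)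
  have he : k =ᵐ[volume] fun x => Real.exp (φ x) * g x :=
    hg.comp hk (T := fun t => Real.exp t - 1) (T' := Real.exp)
      (fun t => (Real.hasDerivAt_exp t).sub_const 1) (.of_forall fun x => rfl)
  exact ⟨h.expm_memLp, (memLp_congr_ae he).1 hk.memLp, by rw [← ft_congr he]; exact hk.ft_eq⟩

end Sol

/-! ### The energy estimate -/

theorem IsPartial.sub {i : Fin d} {u v g k : Rd d → ℝ} (hu : IsPartial i u g)
    (hv : IsPartial i v k) : IsPartial i (fun x => u x - v x) (fun x => g x - k x) := by
  refine ⟨hu.memLp_fun.sub hv.memLp_fun, hu.memLp.sub hv.memLp, ?_⟩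
  filter_upwards [ft_sub hu.memLp_fun hv.memLp_fun, ft_sub hu.memLp hv.memLp, hu.ft_eq, hv.ft_eq]
    with ξ h1 h2 h3 h4
  rw [h1, h2, h3, h4, mul_sub]

theorem integral_sq_eq_ft {u : Rd d → ℝ} (hu : MemLp u 2 volume) :
    ∫ x, u x ^ 2 = ∫ ξ, ‖ft u ξ‖ ^ 2 := by
  simp_rw [sq (u _)]
  rw [integral_mul_eq_ft hu hu]
  congr 1; ext ξ
  rw [Complex.mul_conj, Complex.ofReal_re, Complex.normSq_eq_norm_sq]

/-- ⟨ξ⟩² = 1 + Σ|2πξᵢ|² holds exactly, so no constant is lost; the factor 1/2 in front of the energy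
bound relies on this. -/
theorem sob_one_sq {u : Rd d → ℝ} (hu : MemLp u 2 volume) {G : Fin d → Rd d → ℝ}
    (hG : ∀ i, IsPartial i u (G i)) :
    (sob 1 u).toReal ^ 2 = (∫ x, u x ^ 2) + ∑ i, ∫ x, G i x ^ 2 := by
  have h0 : Integrable (fun ξ => ‖ft u ξ‖ ^ 2) volume := (memLp_ft u).norm.integrable_sq
  have h1 (i : Fin d) : Integrable (fun ξ => ‖ft (G i) ξ‖ ^ 2) volume :=
    (memLp_ft (G i)).norm.integrable_sq
  rw [← ENNReal.toReal_pow, sob_sq, integral_sq_eq_ft hu]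
  simp_rw [integral_sq_eq_ft (hG _).memLp]
  rw [← integral_finsetSum _ (fun i _ => h1 i), ← integral_add h0 (integrable_finsetSum _
    fun i _ => h1 i), integral_eq_lintegral_of_nonneg_ae]
  · congr 1
    apply lintegral_congr_ae
    filter_upwards [ae_all_iff.2 fun i => (hG i).ft_eq] with ξ hξ
    simp_rw [hξ, norm_mul, mul_pow]
    rw [← Finset.sum_mul, sum_norm_dSymbol_sq, ← one_add_mul, ← lamSymbol_one_sq, wt, ← ofReal_norm,
      ← ENNReal.ofReal_pow (lamSymbol_pos 1 ξ).le, ← ENNReal.ofReal_pow (norm_nonneg _),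
      ← ENNReal.ofReal_mul (by positivity)]
  · exact .of_forall fun ξ => by positivity
  · exact (h0.add (integrable_finsetSum _ fun i _ => h1 i)).1

theorem integrable_mul_of_memLp {u v : Rd d → ℝ} (hu : MemLp u 2 volume) (hv : MemLp v 2 volume) :
    Integrable (fun x => u x * v x) volume := hu.integrable_mul hv

/-- Young's inequality for the `L²` pairing. -/
theorem integral_mul_le_young {u v : Rd d → ℝ} (hu : MemLp u 2 volume) (hv : MemLp v 2 volume)
    {c : ℝ} (hc : 0 < c) :
    ∫ x, u x * v x ≤ 1 / (2 * c) * (∫ x, u x ^ 2) + c / 2 * ∫ x, v x ^ 2 := by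
  rw [← integral_const_mul, ← integral_const_mul,
    ← integral_add (hu.integrable_sq.const_mul _) (hv.integrable_sq.const_mul _)]
  apply integral_mono (integrable_mul_of_memLp hu hv)
    ((hu.integrable_sq.const_mul _).add (hv.integrable_sq.const_mul _))
  intro x
  have : 0 ≤ 1 / (2 * c) * (u x - c * v x) ^ 2 := by positivity
  have e : 1 / (2 * c) * (u x - c * v x) ^ 2 =
      1 / (2 * c) * u x ^ 2 + c / 2 * v x ^ 2 - u x * v x := by field_simp; ring
  simp only [Pi.add_apply]
  linarith

/-- For t ≥ 0, e^t - 1 ≥ t ≥ ct. For t ≤ 0, the inequality e^{-t} ≥ 1 - t gives e^t - 1 ≤ t e^t ≤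
ct, and multiplication by t reverses it. -/
theorem mul_sq_le_exp_sub_one_mul {c t : ℝ} (hc : 0 < c) (hc1 : c ≤ 1) (ht : Real.log c ≤ t) :
    c * t ^ 2 ≤ (Real.exp t - 1) * t := by
  have h1 := Real.add_one_le_exp t
  rcases le_total 0 t with h | h
  · nlinarith
  · have h2 : c ≤ Real.exp t := by rw [← Real.exp_log hc]; exact Real.exp_le_exp.2 ht
    have h3 := Real.add_one_le_exp (-t)
    have h4 : Real.exp t * Real.exp (-t) = 1 := by rw [← Real.exp_add]; simp
    have h5 : Real.exp t - 1 ≤ c * t := by nlinarith [Real.exp_pos t]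
    nlinarith

namespace Sol

variable {c b : ℝ} {n φ : Rd d → ℝ}

/-- The energy estimate. -/
theorem energy (h : Sol c b n φ) {G : Fin d → Rd d → ℝ} (hG : ∀ i, IsPartial i φ (G i)) :
    c / 2 * (∫ x, φ x ^ 2) + 1 / 2 * (∑ i, ∫ x, G i x ^ 2) +
      (∫ x, (Real.exp (φ x) - 1 - n x) ^ 2) +
      2 * (∑ i, ∫ x, Real.exp (φ x) * G i x ^ 2) + 1 / 2 * (∫ x, expm φ x ^ 2) ≤
      1 / 2 * energyBound c n := by
  have hW := h.expm_memLp
  choose N hN using fun i => exists_isPartial_of_sob_one h.n_memLp h.n_sob i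
  have hE (i : Fin d) := h.isPartial_expm (hG i)
  have hL (i : Fin d) := (hE i).sub (hN i)
  have hint1 := integrable_mul_of_memLp hW h.memLp
  have hint2 := integrable_mul_of_memLp h.n_memLp h.memLp
  have hint3 := integrable_mul_of_memLp h.n_memLp hW
  -- pairing with φ
  have A := sum_integral_partial_mul hG hG h.memLp h.lap_memLp h.lap_ft
  have A2 : ∫ x, (Real.exp (φ x) - 1 - n x) * φ x = (∫ x, expm φ x * φ x) - ∫ x, n x * φ x := by
    rw [← integral_sub hint1 hint2]
    congr 1; ext x; simp only [expm]; ring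
  have A3 : c * ∫ x, φ x ^ 2 ≤ ∫ x, expm φ x * φ x := by
    rw [← integral_const_mul]
    apply integral_mono_ae (h.memLp.integrable_sq.const_mul c) hint1
    filter_upwards [h.bounds] with x hx
    exact mul_sq_le_exp_sub_one_mul h.c_pos h.c_le_one hx.1
  have A4 := integral_mul_le_young h.n_memLp h.memLp h.c_pos
  -- pairing with the Laplacian
  have B := sum_integral_partial_mul hG hL h.lap_memLp h.lap_memLp h.lap_ft
  have B2 (i : Fin d) : ∫ x, G i x * (Real.exp (φ x) * G i x - N i x) =
      (∫ x, Real.exp (φ x) * G i x ^ 2) - ∫ x, N i x * G i x := by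
    rw [← integral_sub]
    · congr 1; ext x; ring
    · refine (integrable_mul_of_memLp (hE i).memLp (hG i).memLp).congr (.of_forall fun x => ?_)
      simp only; ring
    · exact integrable_mul_of_memLp (hN i).memLp (hG i).memLp
  have B3 (i : Fin d) := integral_mul_le_young (hN i).memLp (hG i).memLp one_pos
  have B4 := Finset.sum_le_sum fun i (_ : i ∈ Finset.univ) => B3 i
  -- pairing with `e^φ - 1`
  have C := sum_integral_partial_mul hG hE hW h.lap_memLp h.lap_ft
  have C2 (i : Fin d) : ∫ x, G i x * (Real.exp (φ x) * G i x) =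
      ∫ x, Real.exp (φ x) * G i x ^ 2 := by
    congr 1; ext x; ring
  have C3 : ∫ x, (Real.exp (φ x) - 1 - n x) * expm φ x =
      (∫ x, expm φ x ^ 2) - ∫ x, n x * expm φ x := by
    rw [← integral_sub hW.integrable_sq hint3]
    congr 1; ext x; simp only [expm]; ring
  have C4 := integral_mul_le_young h.n_memLp hW one_pos
  have D := sob_one_sq h.n_memLp hN
  have E : ∫ x, (Real.exp (φ x) - 1 - n x) * (expm φ x - n x) =
      ∫ x, (Real.exp (φ x) - 1 - n x) ^ 2 := by
    congr 1; ext x; simp only [expm]; ring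
  -- Adding the three pairings, Young's inequality absorbs half of c∫φ², half of the gradient term
  -- of the first pairing, and half of ∫(e^φ - 1)². The weight 2 on e^φ|∇φ|² arises because both the
  -- second and the third pairing produce it.
  simp_rw [← sq] at A
  simp_rw [B2, Finset.sum_sub_distrib] at B
  simp_rw [C2] at C
  rw [A2] at A
  rw [E] at B
  rw [C3] at C
  rw [Finset.sum_add_distrib, ← Finset.mul_sum, ← Finset.mul_sum] at B4
  have hc2 : 1 / (2 * c) * ∫ x, n x ^ 2 = 1 / 2 * (1 / c * ∫ x, n x ^ 2) := by
    field_simp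
  rw [energyBound, D]
  rw [hc2] at A4
  norm_num at B4 C4
  linarith

theorem nonneg_terms {G : Fin d → Rd d → ℝ} : 0 ≤ ∫ x, φ x ^ 2 ∧ 0 ≤ ∑ i, ∫ x, G i x ^ 2 ∧
    0 ≤ ∫ x, (Real.exp (φ x) - 1 - n x) ^ 2 ∧ 0 ≤ ∑ i, ∫ x, Real.exp (φ x) * G i x ^ 2 ∧
    0 ≤ ∫ x, expm φ x ^ 2 := by
  refine ⟨integral_nonneg fun x => by positivity, Finset.sum_nonneg fun i _ => integral_nonneg
    fun x => by positivity, integral_nonneg fun x => by positivity, Finset.sum_nonneg fun i _ =>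
    integral_nonneg fun x => ?_, integral_nonneg fun x => by positivity⟩
  have := Real.exp_pos (φ x)
  positivity

end Sol

/-! ### Estimates of Fourier-side norms -/

theorem aestronglyMeasurable_symbol_mul_ft {m : Rd d → ℂ} (hm : Continuous m) (u : Rd d → ℝ) :
    AEStronglyMeasurable (fun ξ => m ξ * ft u ξ) volume :=
  hm.aestronglyMeasurable.mul (aestronglyMeasurable_ft u)

theorem continuous_lamSymbol_complex (s : ℝ) :
    Continuous fun ξ : Rd d => ((lamSymbol s ξ : ℝ) : ℂ) :=
  Complex.continuous_ofReal.comp (continuous_lamSymbol s)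

theorem continuous_gradSymbol (s : ℝ) :
    Continuous fun ξ : Rd d => ((lamSymbol s ξ * (2 * Real.pi * ‖ξ‖) : ℝ) : ℂ) :=
  Complex.continuous_ofReal.comp ((continuous_lamSymbol s).mul (by fun_prop))

theorem norm_lam (s : ℝ) (ξ : Rd d) : ‖((lamSymbol s ξ : ℝ) : ℂ)‖ = lamSymbol s ξ := by
  rw [Complex.norm_real, Real.norm_of_nonneg (lamSymbol_pos s ξ).le]

theorem norm_grad (s : ℝ) (ξ : Rd d) :
    ‖((lamSymbol s ξ * (2 * Real.pi * ‖ξ‖) : ℝ) : ℂ)‖ = lamSymbol s ξ * (2 * Real.pi * ‖ξ‖) := by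
  have := lamSymbol_pos s ξ
  rw [Complex.norm_real, Real.norm_of_nonneg (by positivity)]

theorem sob_add_le {u v : Rd d → ℝ} (hu : MemLp u 2 volume) (hv : MemLp v 2 volume) (s : ℝ) :
    sob s (fun x => u x + v x) ≤ sob s u + sob s v := by
  apply eLpNorm_le_add (aestronglyMeasurable_symbol_mul_ft (continuous_lamSymbol_complex s) u)
    (aestronglyMeasurable_symbol_mul_ft (continuous_lamSymbol_complex s) v)
  filter_upwards [ft_add hu hv] with ξ hξ
  rw [hξ, mul_add]
  exact norm_add_le _ _

theorem sob_sub_le {u v : Rd d → ℝ} (hu : MemLp u 2 volume) (hv : MemLp v 2 volume) (s : ℝ) :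
    sob s (fun x => u x - v x) ≤ sob s u + sob s v := by
  apply eLpNorm_le_add (aestronglyMeasurable_symbol_mul_ft (continuous_lamSymbol_complex s) u)
    (aestronglyMeasurable_symbol_mul_ft (continuous_lamSymbol_complex s) v)
  filter_upwards [ft_sub hu hv] with ξ hξ
  rw [hξ, mul_sub]
  exact norm_sub_le _ _

theorem gradSob_mono {s t : ℝ} (h : s ≤ t) (u : Rd d → ℝ) : gradSob s u ≤ gradSob t u := by
  apply eLpNorm_mono
  intro ξ
  rw [norm_mul, norm_mul, norm_grad, norm_grad]
  gcongr
  exact lamSymbol_mono h ξ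

theorem sob_partial_le {i : Fin d} {u g : Rd d → ℝ} (h : IsPartial i u g) (s : ℝ) :
    sob s g ≤ gradSob s u := by
  apply eLpNorm_mono_ae
  filter_upwards [h.ft_eq] with ξ hξ
  rw [hξ, ← mul_assoc, norm_mul, norm_mul, norm_mul, norm_lam, norm_grad]
  have := lamSymbol_pos s ξ
  gcongr
  exact norm_dSymbol_le i ξ

theorem eLpNorm_le_sum {f : Rd d → ℂ} {g : Rd d → ℂ} {k : Fin d → Rd d → ℂ}
    (hg : AEStronglyMeasurable g volume) (hk : ∀ i, AEStronglyMeasurable (k i) volume)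
    (h : ∀ᵐ x, ‖f x‖ ≤ ‖g x‖ + ∑ i, ‖k i x‖) :
    eLpNorm f 2 volume ≤ eLpNorm g 2 volume + ∑ i, eLpNorm (k i) 2 volume := by
  simp_rw [← eLpNorm_norm g, ← eLpNorm_norm (k _)]
  have h1 : AEStronglyMeasurable (fun x => ∑ i, ‖k i x‖) volume :=
    Finset.aestronglyMeasurable_fun_sum _ fun i _ => (hk i).norm
  have h2 : eLpNorm (fun x => ∑ i, ‖k i x‖) 2 volume ≤ ∑ i, eLpNorm (fun x => ‖k i x‖) 2 volume := by
    have := eLpNorm_sum_le (p := 2) (s := Finset.univ) (f := fun i x => ‖k i x‖)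
      (μ := (volume : Measure (Rd d))) (fun i _ => (hk i).norm) (by norm_num)
    refine le_trans (le_of_eq ?_) this
    congr 1; ext x; simp
  refine le_trans ?_ (add_le_add_right h2 _)
  refine le_trans ?_ (eLpNorm_add_le hg.norm h1 (by norm_num))
  apply eLpNorm_mono_ae
  filter_upwards [h] with x hx
  exact hx.trans (le_abs_self _)

/-- From ⟨ξ⟩ ≤ 1 + Σ|2πξᵢ|. -/
theorem sob_succ_le {u : Rd d → ℝ} {G : Fin d → Rd d → ℝ} (hG : ∀ i, IsPartial i u (G i)) (s : ℝ) :
    sob (s + 1) u ≤ sob s u + ∑ i, sob s (G i) := by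
  apply eLpNorm_le_sum (aestronglyMeasurable_symbol_mul_ft (continuous_lamSymbol_complex s) u)
    (fun i => aestronglyMeasurable_symbol_mul_ft (continuous_lamSymbol_complex s) (G i))
  filter_upwards [ae_all_iff.2 fun i => (hG i).ft_eq] with ξ hξ
  simp_rw [hξ, norm_mul, norm_lam]
  rw [← Finset.mul_sum, ← Finset.sum_mul, ← mul_add, ← one_add_mul, lamSymbol_add, mul_assoc]
  have := lamSymbol_pos s ξ
  gcongr
  apply le_of_sq_le_sq _ (by positivity)
  rw [lamSymbol_one_sq, ← sum_norm_dSymbol_sq]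
  have h2 : 0 ≤ ∑ i, ‖dSymbol i ξ‖ := by positivity
  have h1 : ∑ i, ‖dSymbol i ξ‖ ^ 2 ≤ (∑ i, ‖dSymbol i ξ‖) ^ 2 :=
    Finset.sum_sq_le_sq_sum_of_nonneg fun i _ => norm_nonneg _
  nlinarith

theorem two_rpow_bound {t : ℝ} (ht : 0 ≤ t) {ξ : Rd d} (h : 2 * Real.pi * ‖ξ‖ ≤ 1) :
    lamSymbol t ξ ≤ 2 ^ t := by
  have e : (2 : ℝ) ^ t = 4 ^ (t / 2) := by
    rw [show (4 : ℝ) = 2 ^ (2 : ℝ) by norm_num, ← Real.rpow_mul (by norm_num)]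
    congr 1; ring
  rw [e, lamSymbol]
  have : 0 ≤ 2 * Real.pi * ‖ξ‖ := by positivity
  gcongr
  nlinarith

/-- Low frequencies, 2π|ξ| ≤ 1, have weight at most 2^{s+1}; at high frequencies ⟨ξ⟩ ≤ 2·2π|ξ|. The
low-frequency term keeps its factor |ξ|, so it is charged to ∇φ and not to φ, whose L² norm is not
bounded uniformly in c. -/
theorem lamSymbol_succ_mul_le {s : ℝ} (hs : 0 ≤ s) (ξ : Rd d) :
    lamSymbol (s + 1) ξ * (2 * Real.pi * ‖ξ‖) ≤
      2 ^ (s + 1) * (2 * Real.pi * ‖ξ‖) + 2 * (lamSymbol s ξ * (2 * Real.pi * ‖ξ‖) ^ 2) := by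
  have hx : 0 ≤ 2 * Real.pi * ‖ξ‖ := by positivity
  have hl := lamSymbol_pos s ξ
  rcases le_total (2 * Real.pi * ‖ξ‖) 1 with h | h
  · have := two_rpow_bound (by linarith : 0 ≤ s + 1) h
    have h2 : 0 ≤ 2 * (lamSymbol s ξ * (2 * Real.pi * ‖ξ‖) ^ 2) := by positivity
    nlinarith
  · have h1 : lamSymbol 1 ξ ≤ 2 * (2 * Real.pi * ‖ξ‖) := by
      apply le_of_sq_le_sq _ (by positivity)
      rw [lamSymbol_one_sq]
      nlinarith
    have h2 : 0 ≤ (2 : ℝ) ^ (s + 1) * (2 * Real.pi * ‖ξ‖) := by positivity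
    rw [lamSymbol_add]
    calc lamSymbol s ξ * lamSymbol 1 ξ * (2 * Real.pi * ‖ξ‖)
        ≤ lamSymbol s ξ * (2 * (2 * Real.pi * ‖ξ‖)) * (2 * Real.pi * ‖ξ‖) := by gcongr
      _ = 2 * (lamSymbol s ξ * (2 * Real.pi * ‖ξ‖) ^ 2) := by ring
      _ ≤ _ := by linarith

theorem lamSymbol_add_two_le {s : ℝ} (hs : 0 ≤ s) (ξ : Rd d) :
    lamSymbol (s + 2) ξ ≤ 2 ^ (s + 2) + 2 * (lamSymbol s ξ * (2 * Real.pi * ‖ξ‖) ^ 2) := by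
  have hl := lamSymbol_pos s ξ
  rcases le_total (2 * Real.pi * ‖ξ‖) 1 with h | h
  · have := two_rpow_bound (by linarith : 0 ≤ s + 2) h
    have h2 : 0 ≤ 2 * (lamSymbol s ξ * (2 * Real.pi * ‖ξ‖) ^ 2) := by positivity
    linarith
  · have h2 : (0 : ℝ) ≤ 2 ^ (s + 2) := by positivity
    rw [lamSymbol_add, lamSymbol_two]
    nlinarith [mul_le_mul_of_nonneg_left (by nlinarith : 1 ≤ (2 * Real.pi * ‖ξ‖) ^ 2) hl.le]

theorem eLpNorm_const_mul_complex (a : ℝ) (ha : 0 ≤ a) (f : Rd d → ℂ) :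
    eLpNorm (fun ξ => (a : ℂ) * f ξ) 2 volume = ENNReal.ofReal a * eLpNorm f 2 volume := by
  refine (eLpNorm_const_smul (a : ℂ) f 2 volume).trans ?_
  congr 1
  rw [← ofReal_norm, Complex.norm_real, Real.norm_of_nonneg ha]

theorem norm_lapSymbol (ξ : Rd d) : ‖lapSymbol ξ‖ = (2 * Real.pi * ‖ξ‖) ^ 2 := by
  rw [lapSymbol, Complex.norm_real, norm_neg, Real.norm_of_nonneg (by positivity)]

theorem gradSob_succ_le {u ℓ : Rd d → ℝ} (h : ft ℓ =ᵐ[volume] fun ξ => lapSymbol ξ * ft u ξ)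
    {s : ℝ} (hs : 0 ≤ s) :
    gradSob (s + 1) u ≤
      ENNReal.ofReal (2 ^ (s + 1)) * gradSob 0 u + ENNReal.ofReal 2 * sob s ℓ := by
  rw [gradSob, gradSob, sob, ← eLpNorm_const_mul_complex _ (by positivity),
    ← eLpNorm_const_mul_complex _ (by positivity)]
  apply eLpNorm_le_add
    ((aestronglyMeasurable_symbol_mul_ft (continuous_gradSymbol 0) u).const_mul _)
    ((aestronglyMeasurable_symbol_mul_ft (continuous_lamSymbol_complex s) ℓ).const_mul _)
  filter_upwards [h] with ξ hξ
  have := mul_le_mul_of_nonneg_right (lamSymbol_succ_mul_le hs ξ) (norm_nonneg (ft u ξ))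
  rw [hξ]
  rw [norm_mul, norm_mul, norm_mul, norm_mul, norm_mul, norm_mul, norm_grad, norm_grad, norm_lam,
    norm_lapSymbol, Complex.norm_real, Complex.norm_real, lamSymbol_zero,
    Real.norm_of_nonneg (by positivity : (0 : ℝ) ≤ 2 ^ (s + 1)),
    Real.norm_of_nonneg (by positivity : (0 : ℝ) ≤ 2)]
  linarith

/-- Unlike `gradSob_succ_le`, this involves the L² norm of u itself. It serves only to show that φ
lies in H^{s+2}. -/
theorem sob_add_two_le {u ℓ : Rd d → ℝ} (h : ft ℓ =ᵐ[volume] fun ξ => lapSymbol ξ * ft u ξ)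
    {s : ℝ} (hs : 0 ≤ s) :
    sob (s + 2) u ≤
      ENNReal.ofReal (2 ^ (s + 2)) * eLpNorm (ft u) 2 volume + ENNReal.ofReal 2 * sob s ℓ := by
  rw [sob, sob, ← eLpNorm_const_mul_complex _ (by positivity),
    ← eLpNorm_const_mul_complex _ (by positivity)]
  apply eLpNorm_le_add ((aestronglyMeasurable_ft u).const_mul _)
    ((aestronglyMeasurable_symbol_mul_ft (continuous_lamSymbol_complex s) ℓ).const_mul _)
  filter_upwards [h] with ξ hξ
  have := mul_le_mul_of_nonneg_right (lamSymbol_add_two_le hs ξ) (norm_nonneg (ft u ξ))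
  rw [hξ]
  rw [norm_mul, norm_mul, norm_mul, norm_mul, norm_mul, norm_lam, norm_lam, norm_lapSymbol,
    Complex.norm_real, Complex.norm_real,
    Real.norm_of_nonneg (by positivity : (0 : ℝ) ≤ 2 ^ (s + 2)),
    Real.norm_of_nonneg (by positivity : (0 : ℝ) ≤ 2)]
  linarith

theorem gradSob_zero_le {u : Rd d → ℝ} {G : Fin d → Rd d → ℝ} (hG : ∀ i, IsPartial i u (G i)) :
    gradSob 0 u ≤ ∑ i, eLpNorm (G i) 2 volume := by
  have h := eLpNorm_le_sum (f := fun ξ => ((lamSymbol 0 ξ * (2 * Real.pi * ‖ξ‖) : ℝ) : ℂ) * ft u ξ)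
    (g := fun _ => 0) (k := fun i => ft (G i)) aestronglyMeasurable_const
    (fun i => aestronglyMeasurable_ft (G i)) (by
      filter_upwards [ae_all_iff.2 fun i => (hG i).ft_eq] with ξ hξ
      simp only [hξ, norm_mul _ (ft u ξ), norm_zero, zero_add]
      rw [norm_grad, lamSymbol_zero, one_mul, ← Finset.sum_mul]
      gcongr
      apply le_of_sq_le_sq _ (by positivity)
      rw [← sum_norm_dSymbol_sq]
      exact Finset.sum_sq_le_sq_sum_of_nonneg fun i _ => norm_nonneg _)
  simp only [eLpNorm_zero', zero_add] at h
  refine h.trans (le_of_eq ?_)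
  exact Finset.sum_congr rfl fun i _ => eLpNorm_ft (hG i).memLp

/-! ### A priori bounds for solutions -/

namespace Sol

variable {c b : ℝ} {n φ : Rd d → ℝ}

theorem sob_lap_le (h : Sol c b n φ) (s : ℝ) :
    sob s (fun x => Real.exp (φ x) - 1 - n x) ≤ sob s (expm φ) + sob s n :=
  sob_sub_le h.expm_memLp h.n_memLp s

theorem gradSob_succ (h : Sol c b n φ) {s : ℝ} (hs : 0 ≤ s) :
    gradSob (s + 1) φ ≤ ENNReal.ofReal (2 ^ (s + 1)) * gradSob 0 φ +
      ENNReal.ofReal 2 * (sob s (expm φ) + sob s n) :=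
  (gradSob_succ_le h.lap_ft hs).trans (by gcongr; exact h.sob_lap_le s)

/-- The derivative e^φ ∂ᵢφ is split as ∂ᵢφ + (e^φ - 1)∂ᵢφ, so that both factors of the product lie
in L² and the product estimate applies. No composition estimate for the exponential is needed at
level s. -/
theorem sob_expm_succ (h : Sol c b n φ) {s : ℝ} {C : ℝ≥0}
    (hC : ∀ f g : Rd d → ℝ, MemLp f 2 volume → MemLp g 2 volume →
      MemLp (fun x => f x * g x) 2 volume → sob 1 f < ∞ → sob 2 g < ∞ →
      sob s (fun x => f x * g x) ≤ C * (sob s f * sob 2 g + sob 1 f * sob (s + 1) g))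
    (hw : sob 1 (expm φ) < ∞) (hφ : gradSob 2 φ < ∞) :
    sob (s + 1) (expm φ) ≤ sob s (expm φ) + d * (gradSob s φ +
      C * (sob s (expm φ) * gradSob 2 φ + sob 1 (expm φ) * gradSob (s + 1) φ)) := by
  choose G hG using h.exists_partial
  refine (sob_succ_le (fun i => h.isPartial_expm (hG i)) s).trans ?_
  gcongr
  have hi (i : Fin d) : sob s (fun x => Real.exp (φ x) * G i x) ≤ gradSob s φ +
      C * (sob s (expm φ) * gradSob 2 φ + sob 1 (expm φ) * gradSob (s + 1) φ) := by
    have hp := h.isPartial_expm (hG i)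
    have hm : MemLp (fun x => expm φ x * G i x) 2 volume := by
      refine (memLp_congr_ae (.of_forall fun x => ?_)).1 (hp.memLp.sub (hG i).memLp)
      simp only [expm, Pi.sub_apply]; ring
    have e : (fun x => Real.exp (φ x) * G i x) = fun x => G i x + expm φ x * G i x := by
      ext x; simp only [expm]; ring
    rw [e]
    refine (sob_add_le (hG i).memLp hm s).trans ?_
    have h2 := sob_partial_le (hG i) 2
    refine add_le_add (sob_partial_le (hG i) s) ((hC _ _ h.expm_memLp (hG i).memLp hm hw
      (h2.trans_lt hφ)).trans ?_)
    gcongr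
    exact sob_partial_le (hG i) _
  refine (Finset.sum_le_sum fun i _ => hi i).trans ?_
  simp [mul_add]

/-- The size of the data. -/
def size (c b : ℝ) (n : Rd d → ℝ) : ℝ := (1 + energyBound c n) * (1 + b)

theorem energyBound_nonneg (h : Sol c b n φ) : 0 ≤ energyBound c n := by
  have := h.c_pos
  have h1 : 0 ≤ ∫ x, n x ^ 2 := integral_nonneg fun x => by positivity
  unfold energyBound
  positivity

theorem eLpNorm_le_of_integral_sq {g : Rd d → ℝ} (hg : MemLp g 2 volume) {Y : ℝ} (hY : 0 ≤ Y)
    (h : ∫ x, g x ^ 2 ≤ Y ^ 2) : eLpNorm g 2 volume ≤ ENNReal.ofReal Y := by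
  rw [← ENNReal.pow_le_pow_left_iff two_ne_zero, eLpNorm_sq_eq_ofReal hg,
    ← ENNReal.ofReal_pow hY]
  exact ENNReal.ofReal_le_ofReal h

theorem one_le_size (h : Sol c b n φ) : 1 ≤ size c b n ∧ energyBound c n ≤ size c b n ∧
    1 + b ≤ size c b n := by
  have h1 := h.energyBound_nonneg
  have h2 := h.b_nonneg
  unfold size
  refine ⟨?_, ?_, ?_⟩ <;> nlinarith [mul_nonneg h1 h2]

/-- The energy inequality gives squares bounded by the energy bound, which is at most size²; square
roots are avoided because the size is at least 1. The L² norm of φ is absent since its energy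
carries the factor c. -/
theorem eLpNorm_bounds (h : Sol c b n φ) {G : Fin d → Rd d → ℝ} (hG : ∀ i, IsPartial i φ (G i)) :
    eLpNorm (expm φ) 2 volume ≤ ENNReal.ofReal (size c b n) ∧
      ∀ i, eLpNorm (G i) 2 volume ≤ ENNReal.ofReal (size c b n) := by
  have hE := h.energy hG
  obtain ⟨h1, h2, h3, h4, h5⟩ := nonneg_terms (φ := φ) (n := n) (G := G)
  obtain ⟨k1, k2, -⟩ := h.one_le_size
  have hc := h.c_pos
  have h0 : 0 ≤ c / 2 * ∫ x, φ x ^ 2 := by positivity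
  have hsq : energyBound c n ≤ size c b n ^ 2 := by nlinarith
  refine ⟨eLpNorm_le_of_integral_sq h.expm_memLp (by linarith) (by linarith), fun i =>
    eLpNorm_le_of_integral_sq (hG i).memLp (by linarith) ?_⟩
  have := Finset.single_le_sum (f := fun i => ∫ x, G i x ^ 2)
    (fun j _ => integral_nonneg fun x => by positivity) (Finset.mem_univ i)
  linarith

theorem gradSob_zero_bound (h : Sol c b n φ) :
    gradSob 0 φ ≤ d * ENNReal.ofReal (size c b n) := by
  choose G hG using h.exists_partial
  refine (gradSob_zero_le hG).trans ((Finset.sum_le_sum fun i _ =>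
    (h.eLpNorm_bounds hG).2 i).trans ?_)
  simp

theorem sob_one_n_bound (h : Sol c b n φ) : sob 1 n ≤ ENNReal.ofReal (size c b n) := by
  obtain ⟨k1, k2, -⟩ := h.one_le_size
  rw [← ENNReal.ofReal_toReal h.n_sob.ne]
  apply ENNReal.ofReal_le_ofReal
  apply le_of_sq_le_sq _ (by linarith)
  have hc := h.c_pos
  have h1 : 0 ≤ 1 / c * ∫ x, n x ^ 2 :=
    mul_nonneg (by positivity) (integral_nonneg fun x => by positivity)
  have : (sob 1 n).toReal ^ 2 ≤ energyBound c n := by unfold energyBound; linarith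
  nlinarith

/-- The gradient of e^φ - 1 is e^φ∇φ, and e^φ ≤ 1 + b by the maximum principle; each of the two
factors costs one power of the size. -/
theorem sob_one_expm_bound (h : Sol c b n φ) :
    sob 1 (expm φ) ≤ (1 + d) * ENNReal.ofReal (size c b n) ^ 2 := by
  choose G hG using h.exists_partial
  obtain ⟨k1, -, k3⟩ := h.one_le_size
  obtain ⟨e1, e2⟩ := h.eLpNorm_bounds hG
  set X := ENNReal.ofReal (size c b n)
  have hX : 1 ≤ X := by rw [← ENNReal.ofReal_one]; exact ENNReal.ofReal_le_ofReal k1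
  have hXX : X ≤ X ^ 2 := by
    rw [sq]; exact le_mul_of_one_le_left zero_le hX
  have h1 := sob_succ_le (fun i => h.isPartial_expm (hG i)) 0
  rw [zero_add] at h1
  refine h1.trans ?_
  rw [add_mul, one_mul]
  refine add_le_add ?_ ?_
  · rw [sob_zero, eLpNorm_ft h.expm_memLp]
    exact e1.trans hXX
  · have hi (i : Fin d) : sob 0 (fun x => Real.exp (φ x) * G i x) ≤ X ^ 2 := by
      rw [sob_zero, eLpNorm_ft (h.isPartial_expm (hG i)).memLp]
      refine (eLpNorm_le_mul_eLpNorm_of_ae_le_mul (c := 1 + b) (g := G i) ?_ 2).trans ?_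
      · filter_upwards [h.exp_le] with x hx
        rw [norm_mul, Real.norm_of_nonneg (Real.exp_pos _).le]
        gcongr
        exact hx.2
      · rw [sq]
        exact mul_le_mul' (ENNReal.ofReal_le_ofReal k3) (e2 i)
    refine (Finset.sum_le_sum fun i _ => hi i).trans ?_
    simp

end Sol

/-! ### Polynomial domination, uniformly in the data -/

/-- Data of the problem together with a solution. -/
structure Data (d : ℕ) where
  /-- the lower bound of `1 + n` -/
  c : ℝ
  /-- the upper bound of `n` -/
  b : ℝ
  /-- the right-hand side -/
  n : Rd d → ℝ
  /-- the solution -/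
  φ : Rd d → ℝ
  sol : Sol c b n φ

/-- The size of the data in `[0, ∞]`. -/
def Data.x (D : Data d) : ℝ≥0∞ := ENNReal.ofReal (Sol.size D.c D.b D.n)

theorem Data.one_le_x (D : Data d) : 1 ≤ D.x := by
  rw [← ENNReal.ofReal_one]; exact ENNReal.ofReal_le_ofReal D.sol.one_le_size.1

/-- `Q` is bounded by `y` times a polynomial in the size of the data. -/
def Dom (y Q : Data d → ℝ≥0∞) : Prop :=
  ∃ (C : ℝ≥0) (N : ℕ), ∀ D, Q D ≤ C * D.x ^ N * y D

namespace Dom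

variable {y y' Q R : Data d → ℝ≥0∞}

theorem mono (h : Dom y Q) (hR : ∀ D, R D ≤ Q D) : Dom y R := by
  obtain ⟨C, N, h⟩ := h
  exact ⟨C, N, fun D => (hR D).trans (h D)⟩

theorem weaken (h : Dom y Q) (hy : ∀ D, y D ≤ y' D) : Dom y' Q := by
  obtain ⟨C, N, h⟩ := h
  exact ⟨C, N, fun D => (h D).trans (by gcongr; exact hy D)⟩

theorem add (h : Dom y Q) (h' : Dom y R) : Dom y (fun D => Q D + R D) := by
  obtain ⟨C, N, h⟩ := h
  obtain ⟨C', N', h'⟩ := h'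
  refine ⟨C + C', max N N', fun D => (add_le_add (h D) (h' D)).trans ?_⟩
  rw [ENNReal.coe_add, add_mul, add_mul]
  have := D.one_le_x
  gcongr
  · exact le_max_left _ _
  · exact le_max_right _ _

/-- The first factor must be bounded by the size alone, so the product remains linear in y. This
asymmetry encodes tameness. -/
theorem mul (h : Dom (fun _ => 1) Q) (h' : Dom y R) : Dom y (fun D => Q D * R D) := by
  obtain ⟨C, N, h⟩ := h
  obtain ⟨C', N', h'⟩ := h'
  refine ⟨C * C', N + N', fun D => (mul_le_mul' (h D) (h' D)).trans (le_of_eq ?_)⟩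
  rw [ENNReal.coe_mul, pow_add]
  ring

theorem const (C : ℝ≥0) : Dom (fun _ : Data d => 1) (fun _ => (C : ℝ≥0∞)) :=
  ⟨C, 0, fun D => by simp⟩

theorem ofReal (C : ℝ) : Dom (fun _ : Data d => 1) (fun _ => ENNReal.ofReal C) := const _

theorem natCast (k : ℕ) : Dom (fun _ : Data d => 1) (fun _ => (k : ℝ≥0∞)) := by
  simpa using const (d := d) (k : ℝ≥0)

theorem self : Dom (fun _ : Data d => 1) Data.x := ⟨1, 1, fun D => by simp⟩

theorem refl : Dom y y := ⟨1, 0, fun D => by simp⟩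

end Dom

theorem dom_gradSob_zero : Dom (fun _ : Data d => 1) (fun D => gradSob 0 D.φ) :=
  ((Dom.natCast d).mul Dom.self).mono fun D => D.sol.gradSob_zero_bound

theorem dom_sob_one_n : Dom (fun _ : Data d => 1) (fun D => sob 1 D.n) :=
  Dom.self.mono fun D => D.sol.sob_one_n_bound

theorem dom_sob_one_expm : Dom (fun _ : Data d => 1) (fun D => sob 1 (expm D.φ)) := by
  have h := (Dom.natCast (d := d) (1 + d)).mul (Dom.self.mul Dom.self)
  refine h.mono fun D => ?_
  have := D.sol.sob_one_expm_bound
  rw [Data.x, ← sq]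
  simpa using this

theorem dom_gradSob_succ {y : Data d → ℝ≥0∞} {s : ℝ} (hs : 0 ≤ s) (hy : ∀ D, 1 ≤ y D)
    (hn : Dom y fun D => sob s D.n) (hw : Dom y fun D => sob s (expm D.φ)) :
    Dom y fun D => gradSob (s + 1) D.φ := by
  have h := ((Dom.ofReal (2 ^ (s + 1))).mul (dom_gradSob_zero.weaken hy)).add
    ((Dom.ofReal 2).mul (hw.add hn))
  exact h.mono fun D => D.sol.gradSob_succ hs

/-- The start of the bootstrap: the elliptic gain at s = 1 uses only H¹ norms, so the factor |Λ²∇φ|₂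
in the products costs no higher norm of n. -/
theorem dom_gradSob_two : Dom (fun _ : Data d => 1) (fun D => gradSob 2 D.φ) := by
  have := dom_gradSob_succ zero_le_one (fun _ => le_rfl) (dom_sob_one_n (d := d)) dom_sob_one_expm
  norm_num at this
  exact this

theorem Dom.lt_top {y Q : Data d → ℝ≥0∞} (h : Dom y Q) {D : Data d} (hy : y D < ∞) : Q D < ∞ := by
  obtain ⟨C, N, h⟩ := h
  exact (h D).trans_lt (ENNReal.mul_lt_top (ENNReal.mul_lt_top ENNReal.coe_lt_top
    (ENNReal.pow_lt_top ENNReal.ofReal_lt_top)) hy)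

theorem dom_sob_n (s : ℝ) : Dom (fun D : Data d => 1 + sob s D.n) (fun D => sob s D.n) :=
  Dom.refl.mono fun _ => le_add_self

/-- Tame bounds for `e^φ - 1` in `Hˢ`. -/
theorem dom_sob_expm (hd : d ≤ 3) (k : ℕ) : ∀ s : ℝ, 0 ≤ s → s ≤ k + 1 →
    Dom (fun D : Data d => 1 + sob s D.n) (fun D => sob s (expm D.φ)) := by
  induction k with
  | zero =>
    intro s hs hs1
    refine (dom_sob_one_expm.weaken fun D => le_self_add).mono fun D => sob_mono ?_ _
    simpa using hs1
  | succ k ih =>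
    intro s hs hsk
    rcases le_total s 1 with h1 | h1
    · exact (dom_sob_one_expm.weaken fun D => le_self_add).mono fun D => sob_mono h1 _
    obtain ⟨t, rfl⟩ : ∃ t, s = t + 1 := ⟨s - 1, by ring⟩
    have ht : 0 ≤ t := by linarith
    have hw := ih t ht (by push_cast at hsk; linarith)
    have hg := dom_gradSob_succ ht (fun D => le_self_add) (dom_sob_n t) hw
    obtain ⟨C, hC⟩ := exists_sob_mul_le hd ht
    have hw1 (D : Data d) : sob 1 (expm D.φ) < ∞ := dom_sob_one_expm.lt_top ENNReal.one_lt_top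
    have hg2 (D : Data d) : gradSob 2 D.φ < ∞ := dom_gradSob_two.lt_top ENNReal.one_lt_top
    -- In each product the low factor, of level Λ²∇φ or H¹, is polynomial in the size, and the other
    -- is linear in 1 + |n|_{H^t}. The weight is then relaxed from t to t + 1.
    have key := hw.add ((Dom.natCast d).mul ((hg.mono fun D => gradSob_mono (by linarith) D.φ).add
      ((Dom.const C).mul ((dom_gradSob_two.mul hw).add (dom_sob_one_expm.mul hg)))))
    refine (key.weaken (fun D => ?_)).mono fun D => ?_
    · gcongr
      exact sob_mono (by linarith) _
    · refine (D.sol.sob_expm_succ hC (hw1 D) (hg2 D)).trans (le_of_eq ?_)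
      rw [mul_comm (sob t (expm D.φ)) (gradSob 2 D.φ)]

theorem dom_sob_expm' (hd : d ≤ 3) {s : ℝ} (hs : 0 ≤ s) :
    Dom (fun D : Data d => 1 + sob s D.n) (fun D => sob s (expm D.φ)) := by
  obtain ⟨k, hk⟩ := exists_nat_ge s
  exact dom_sob_expm hd k s hs (by linarith)

theorem dom_gradSob (hd : d ≤ 3) {s : ℝ} (hs : 0 ≤ s) :
    Dom (fun D : Data d => 1 + sob s D.n) (fun D => gradSob (s + 1) D.φ) :=
  dom_gradSob_succ hs (fun _ => le_self_add) (dom_sob_n s) (dom_sob_expm' hd hs)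

/-- Elliptic regularity: `φ ∈ Hˢ⁺²` if `n ∈ Hˢ`. -/
theorem Sol.sob_add_two_lt_top (hd : d ≤ 3) {c b : ℝ} {n φ : Rd d → ℝ} (h : Sol c b n φ) {s : ℝ}
    (hs : 0 ≤ s) (hn : sob s n < ∞) : sob (s + 2) φ < ∞ := by
  have hw : sob s (expm φ) < ∞ :=
    (dom_sob_expm' hd hs).lt_top (D := ⟨c, b, n, φ, h⟩) (ENNReal.add_lt_top.2 ⟨by simp, hn⟩)
  refine (sob_add_two_le h.lap_ft hs).trans_lt (ENNReal.add_lt_top.2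
    ⟨ENNReal.mul_lt_top ENNReal.ofReal_lt_top (memLp_ft φ).2,
      ENNReal.mul_lt_top ENNReal.ofReal_lt_top ?_⟩)
  exact (h.sob_lap_le s).trans_lt (ENNReal.add_lt_top.2 ⟨hw, hn⟩)

/-! ### The bounds of the right-hand side -/

theorem ae_abs_le_lpNorm {n : Rd d → ℝ} (hn : MemLp n ∞ volume) :
    ∀ᵐ x, |n x| ≤ lpNorm n ∞ volume := by
  rw [← toReal_eLpNorm hn.1]
  filter_upwards [ae_le_eLpNormEssSup (f := n) (μ := volume)] with x hx
  rw [← eLpNorm_exponent_top] at hx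
  have := ENNReal.toReal_mono hn.2.ne hx
  rwa [toReal_enorm, Real.norm_eq_abs] at this

theorem ae_cInf_le {n : Rd d → ℝ} (hn : MemLp n ∞ volume) : ∀ᵐ x, cInf n ≤ 1 + n x := by
  refine ae_essInf_le ⟨1 - lpNorm n ∞ volume, ?_⟩
  rw [eventually_map]
  filter_upwards [ae_abs_le_lpNorm hn] with x hx
  have := abs_le.1 hx
  simp only [ge_iff_le]
  linarith

theorem one_sub_le_cInf (hd : 1 ≤ d) {n : Rd d → ℝ} (hn : MemLp n ∞ volume) :
    1 - lpNorm n ∞ volume ≤ cInf n := by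
  have : Nonempty (Fin d) := ⟨⟨0, hd⟩⟩
  have hb := ae_abs_le_lpNorm hn
  refine le_essInf_of_ae_le _ (hb.mono fun x hx => ?_) ?_
  · have := abs_le.1 hx
    simp only
    linarith
  · refine IsBoundedUnder.isCoboundedUnder_ge ⟨1 + lpNorm n ∞ volume, ?_⟩
    rw [eventually_map]
    filter_upwards [hb] with x hx
    have := abs_le.1 hx
    linarith

/-- Otherwise n would dominate a positive constant, which is not in L² of a space of infinite
volume. For d = 0 the volume is finite, hence d ≥ 1. -/
theorem cInf_le_one (hd : 1 ≤ d) {n : Rd d → ℝ} (hn : MemLp n ∞ volume) (hn2 : MemLp n 2 volume) :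
    cInf n ≤ 1 := by
  have : Nonempty (Fin d) := ⟨⟨0, hd⟩⟩
  by_contra! hc
  have h1 : MemLp (fun _ : Rd d => cInf n - 1) 2 volume := by
    refine hn2.of_le aestronglyMeasurable_const ?_
    filter_upwards [ae_cInf_le hn] with x hx
    rw [Real.norm_of_nonneg (by linarith), Real.norm_of_nonneg (by linarith)]
    linarith
  rw [memLp_const_iff (by norm_num) (by norm_num)] at h1
  rcases h1 with h1 | h1
  · linarith
  · simp at h1

/-! ### Conclusions in terms of the data -/

namespace Sol

variable {c b : ℝ} {n φ : Rd d → ℝ}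

theorem solves (h : Sol c b n φ) :
    IsLaplacian φ (fun x => Real.exp (φ x) - 1 - n x) :=
  (isLaplacian_iff h.memLp).2 ⟨h.lap_memLp, h.lap_ft⟩

theorem exists_grad_energy (h : Sol c b n φ) :
    ∃ G : Rd d → Rd d, IsGrad φ G ∧
      Integrable (fun x => c / 2 * φ x ^ 2 + 1 / 2 * ‖G x‖ ^ 2 + (Real.exp (φ x) - 1 - n x) ^ 2
        + 2 * Real.exp (φ x) * ‖G x‖ ^ 2 + 1 / 2 * (Real.exp (φ x) - 1) ^ 2) volume ∧
      ∫ x, (c / 2 * φ x ^ 2 + 1 / 2 * ‖G x‖ ^ 2 + (Real.exp (φ x) - 1 - n x) ^ 2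
        + 2 * Real.exp (φ x) * ‖G x‖ ^ 2 + 1 / 2 * (Real.exp (φ x) - 1) ^ 2)
        ≤ 1 / 2 * energyBound c n := by
  choose G hG using h.exists_partial
  refine ⟨fun x => WithLp.toLp 2 fun i => G i x, fun i =>
    (isL2Function_partialD_iff h.memLp i).2 ⟨(hG i).memLp, (hG i).ft_eq⟩, ?_⟩
  have e (x : Rd d) : c / 2 * φ x ^ 2 + 1 / 2 * ‖(WithLp.toLp 2 fun i => G i x : Rd d)‖ ^ 2
        + (Real.exp (φ x) - 1 - n x) ^ 2
        + 2 * Real.exp (φ x) * ‖(WithLp.toLp 2 fun i => G i x : Rd d)‖ ^ 2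
        + 1 / 2 * (Real.exp (φ x) - 1) ^ 2 =
      c / 2 * φ x ^ 2 + 1 / 2 * (∑ i, G i x ^ 2) + (Real.exp (φ x) - 1 - n x) ^ 2
        + 2 * (∑ i, Real.exp (φ x) * G i x ^ 2) + 1 / 2 * expm φ x ^ 2 := by
    rw [EuclideanSpace.real_norm_sq_eq, ← Finset.mul_sum, expm]
    ring
  simp_rw [e]
  have i1 := h.memLp.integrable_sq.const_mul (c / 2)
  have j2 (i : Fin d) := (hG i).memLp.integrable_sq
  have i2 := (integrable_finsetSum Finset.univ fun i _ => j2 i).const_mul (1 / 2)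
  have i3 := h.lap_memLp.integrable_sq
  have j4 (i : Fin d) : Integrable (fun x => Real.exp (φ x) * G i x ^ 2) volume :=
    (integrable_mul_of_memLp (h.isPartial_expm (hG i)).memLp (hG i).memLp).congr
      (.of_forall fun x => by ring)
  have i4 := (integrable_finsetSum Finset.univ fun i _ => j4 i).const_mul 2
  have i5 := h.expm_memLp.integrable_sq.const_mul (1 / 2)
  have k2 := i1.fun_add i2
  have k3 := k2.fun_add i3
  have k4 := k3.fun_add i4
  refine ⟨k4.fun_add i5, le_trans (le_of_eq ?_) (h.energy hG)⟩
  rw [integral_add k4 i5, integral_add k3 i4, integral_add k2 i3, integral_add i1 i2, integral_const_mul, integral_const_mul,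
    integral_const_mul, integral_const_mul, integral_finsetSum _ fun i _ => j2 i,
    integral_finsetSum _ fun i _ => j4 i]

end Sol

theorem energyBound_cInf {n : Rd d → ℝ} (hn : MemLp n 2 volume) :
    energyBound (cInf n) n = I1 n := by
  have h : ∫ x, n x ^ 2 = lpNorm n 2 volume ^ 2 := by
    rw [← toReal_eLpNorm hn.1, ← ENNReal.toReal_pow, eLpNorm_sq_eq_ofReal hn,
      ENNReal.toReal_ofReal (integral_nonneg fun x => sq_nonneg _)]
  rw [energyBound, I1, hsNorm_eq hn, h]

theorem exists_sol (hd : 1 ≤ d) {n : Rd d → ℝ} (hn : MemLp n ∞ volume) (hn1 : MemHs 1 n)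
    (hc : 0 < cInf n) : ∃ φ : Rd d → ℝ, Sol (cInf n) (lpNorm n ∞ volume) n φ := by
  obtain ⟨h2, h1⟩ := (memHs_iff zero_le_one).1 hn1
  obtain ⟨φ, k1, k2, k3, k4⟩ := exists_solution hc (cInf_le_one hd hn h2) lpNorm_nonneg h2
    (ae_cInf_le hn) ((ae_abs_le_lpNorm hn).mono fun x hx => (le_abs_self _).trans hx)
  exact ⟨φ, hc, cInf_le_one hd hn h2, lpNorm_nonneg, h2, h1, k1, k2, k3, k4⟩

/-- The constant of the regularity estimate. -/
def regConst (C : ℝ≥0) (N : ℕ) (a b : ℝ) : ℝ :=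
  -- The maxima make the polynomial monotone on all of ℝ, and the summands a + b make the whole
  -- strictly increasing. For the nonnegative arguments that occur they only enlarge the constant.
  C * ((1 + max a 0) * (1 + max b 0)) ^ N + a + b

theorem regConst_strictMono_left (C : ℝ≥0) (N : ℕ) (b : ℝ) :
    StrictMono fun a => regConst C N a b := by
  intro a a' h
  have : 0 ≤ max a 0 := le_max_right _ _
  have : 0 ≤ max b 0 := le_max_right _ _
  have h1 : (C : ℝ) * ((1 + max a 0) * (1 + max b 0)) ^ N ≤
      C * ((1 + max a' 0) * (1 + max b 0)) ^ N := by gcongr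
  simp only [regConst]
  linarith

theorem regConst_strictMono_right (C : ℝ≥0) (N : ℕ) (a : ℝ) :
    StrictMono fun b => regConst C N a b := by
  intro b b' h
  have : 0 ≤ max a 0 := le_max_right _ _
  have : 0 ≤ max b 0 := le_max_right _ _
  have h1 : (C : ℝ) * ((1 + max a 0) * (1 + max b 0)) ^ N ≤
      C * ((1 + max a 0) * (1 + max b' 0)) ^ N := by gcongr
  simp only [regConst]
  linarith

theorem exists_regConst (hd : d ≤ 3) {s : ℝ} (hs : 0 ≤ s) : ∃ (C : ℝ≥0) (N : ℕ),
    ∀ (c b : ℝ) (n φ : Rd d → ℝ), Sol c b n φ → sob s n < ∞ →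
      gradSob (s + 1) φ ≤
        ENNReal.ofReal (regConst C N (energyBound c n) b * (1 + (sob s n).toReal)) := by
  obtain ⟨C, N, h⟩ := dom_gradSob hd hs
  refine ⟨C, N, fun c b n φ hφ hn => (h ⟨c, b, n, φ, hφ⟩).trans ?_⟩
  have h0 := hφ.energyBound_nonneg
  have hb := hφ.b_nonneg
  have e : (C : ℝ≥0∞) * Data.x ⟨c, b, n, φ, hφ⟩ ^ N * (1 + sob s n) = ENNReal.ofReal
      (C * ((1 + energyBound c n) * (1 + b)) ^ N * (1 + (sob s n).toReal)) := by
    rw [ENNReal.ofReal_mul (by positivity), ENNReal.ofReal_mul (by positivity),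
      ENNReal.ofReal_pow (by positivity), ENNReal.ofReal_add zero_le_one ENNReal.toReal_nonneg,
      ENNReal.ofReal_toReal hn.ne, ENNReal.ofReal_one, ENNReal.ofReal_coe_nnreal]
    rfl
  refine e.le.trans (ENNReal.ofReal_le_ofReal ?_)
  rw [regConst, max_eq_left h0, max_eq_left hb]
  gcongr
  linarith

end

end EulerPoisson

/-! ### The proposition -/

open EulerPoisson

theorem mainTheorem6 (d : ℕ) (hd1 : 1 ≤ d) (hd3 : d ≤ 3) :
    ∃ F : ℝ → ℝ → ℝ → ℝ,
      (∀ s : ℝ, 0 ≤ s →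
        (∀ b : ℝ, StrictMono (fun a => F s a b)) ∧ (∀ a : ℝ, StrictMono (fun b => F s a b))) ∧
      ∀ n : Rd d → ℝ, MemLp n ∞ volume → MemHs 1 n → 0 < cInf n →
        ∃ φ : Rd d → ℝ,
          (MemHs 3 φ ∧ Solves n φ) ∧
          (∀ ψ : Rd d → ℝ, MemHs 3 ψ → Solves n ψ → ψ =ᵐ[volume] φ) ∧
          -- (i)
          ((∀ᵐ x, Real.log (cInf n) ≤ φ x ∧ φ x ≤ Real.log (1 + lpNorm n ∞ volume)) ∧
            (lpNorm n ∞ volume < 1 → ∀ᵐ x, Real.log (1 - lpNorm n ∞ volume) ≤ φ x)) ∧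
          -- (ii)
          (∃ (G : Rd d → Rd d) (ℓ : Rd d → ℝ), IsGrad φ G ∧ IsLaplacian φ ℓ ∧
            Integrable (fun x => cInf n / 2 * φ x ^ 2 + 1 / 2 * ‖G x‖ ^ 2 + ℓ x ^ 2
              + 2 * Real.exp (φ x) * ‖G x‖ ^ 2 + 1 / 2 * (Real.exp (φ x) - 1) ^ 2) volume ∧
            ∫ x, (cInf n / 2 * φ x ^ 2 + 1 / 2 * ‖G x‖ ^ 2 + ℓ x ^ 2
              + 2 * Real.exp (φ x) * ‖G x‖ ^ 2 + 1 / 2 * (Real.exp (φ x) - 1) ^ 2)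
              ≤ 1 / 2 * I1 n) ∧
          -- (iii)
          (∀ s : ℝ, 0 ≤ s → MemHs s n →
            MemHs (s + 2) φ ∧
            lamGradNorm (s + 1) φ
              ≤ ENNReal.ofReal (F s (I1 n) (lpNorm n ∞ volume) * (1 + hsNorm s n))) := by
  -- The constants are fixed for each s before n is introduced, so F depends only on s and d.
  choose! C N hCN using fun (s : ℝ) (hs : 0 ≤ s) => exists_regConst hd3 hs
  refine ⟨fun s => regConst (C s) (N s), fun s _ => ⟨regConst_strictMono_left _ _,
    regConst_strictMono_right _ _⟩, fun n hn hn1 hc => ?_⟩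
  obtain ⟨φ, h⟩ := exists_sol hd1 hn hn1 hc
  have hreg (s : ℝ) (hs : 0 ≤ s) (hns : sob s n < ∞) : MemHs (s + 2) φ :=
    (memHs_iff (by linarith)).2 ⟨h.memLp, h.sob_add_two_lt_top hd3 hs hns⟩
  have hS : Solves n φ := ⟨_, h.solves, .of_forall fun x => by ring⟩
  have h3 : MemHs 3 φ := by
    have := hreg 1 zero_le_one h.n_sob
    norm_num at this
    exact this
  refine ⟨φ, ⟨h3, hS⟩, fun ψ hψ hψS => solves_unique h.memLp hψ.1 hS hψS, ⟨h.bounds, fun hb => ?_⟩,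
    ?_, fun s hs hns => ?_⟩
  · filter_upwards [h.bounds] with x hx
    exact (Real.log_le_log (by linarith) (one_sub_le_cInf hd1 hn)).trans hx.1
  · obtain ⟨G, hG, hi, hE⟩ := h.exists_grad_energy
    rw [energyBound_cInf h.n_memLp] at hE
    exact ⟨G, _, hG, h.solves, hi, hE⟩
  · have hsn := ((memHs_iff hs).1 hns).2
    refine ⟨hreg s hs hsn, ?_⟩
    rw [lamGradNorm_eq h.memLp, ← energyBound_cInf h.n_memLp, hsNorm_eq h.n_memLp]
    exact hCN s hs _ _ _ _ h hsn
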